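/- A \emph{planar Lombardi drawing} of a finite simple graph $G$ is a drawing of $G$ in the Euclidean plane in which the vertices are distinct points; every edge is drawn as a circular arc (less than a full circle) or a straight line segment between its two end vertices; no edge passes through a vertex other than its ends, and two different edges meet at most in common end vertices; and around every vertex $v$ the edges leave $v$ in equally spaced directions, i.e. at angles $\theta_v + 2\pi k/\deg(v)$, $0 \le k < \deg(v)$, for some $\theta_v$ (perfect angular resolution). Let $G_{18}$ be the simple graph with 18 vertices $a,b,c,d,e,f,x_0,\dots,x_5,y_0,\dots,y_5$ and the following 36 edges: $a$ and $f$ are both joined to each of $b,c,d,e$; $ce$ and $bd$ are edges; $x_0,\dots,x_5$ span an octahedron (with opposite pairs $x_ix_{i+3}$, $i=0,1,2$) from which the edge $x_0x_1$ is removed, and $cx_0$, $ex_1$ are edges; likewise $y_0,\dots,y_5$ span an octahedron (with opposite pairs $y_iy_{i+3}$, $i=0,1,2$) from which the edge $y_0y_1$ is removed, and $by_0$, $dy_1$ are edges. \textbf{Theorem.} The graph $G_{18}$ is 4-regular, 2-connected and planar, and it has no planar Lombardi drawing. Hence not every finite 4-regular planar graph has a planar Lombardi drawing. -/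

import Mathlib

open Set

/-- A drawing of a simple graph in the Euclidean plane `ℂ`: distinct points for the vertices, and for
every dart (oriented edge) a continuous curve, parametrized by `[0, 1]`, from the first to the second
end; the two orientations of an edge are drawn as the same curve, traversed in opposite directions.
Values of the curves outside `[0, 1]` carry no meaning. -/
structure GraphDrawing {V : Type*} (G : SimpleGraph V) where
  pos : V → ℂ
  pos_injective : Function.Injective pos
  curve : G.Dart → ℝ → ℂ
  continuousOn_curve : ∀ d, ContinuousOn (curve d) (Icc 0 1)
  curve_zero : ∀ d, curve d 0 = pos d.fst
  curve_one : ∀ d, curve d 1 = pos d.snd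
  curve_symm : ∀ d, ∀ t ∈ Icc (0 : ℝ) 1, curve d.symm t = curve d (1 - t)

/-- The drawing has no crossings: every edge is a simple curve, edges do not pass through vertices, and
two different edges meet at most in common end vertices. -/
structure GraphDrawing.IsPlanar {V : Type*} {G : SimpleGraph V} (D : GraphDrawing G) : Prop where
  simple : ∀ d, InjOn (D.curve d) (Icc 0 1)
  avoids_vertices : ∀ d, ∀ t ∈ Ioo (0 : ℝ) 1, ∀ v, D.curve d t ≠ D.pos v
  avoids_edges : ∀ d d' : G.Dart, d.edge ≠ d'.edge →
    ∀ t ∈ Ioo (0 : ℝ) 1, ∀ t' ∈ Ioo (0 : ℝ) 1, D.curve d t ≠ D.curve d' t'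

/-- A planar graph: a graph that has a drawing without crossings. -/
def IsPlanarGraph {V : Type*} (G : SimpleGraph V) : Prop :=
  ∃ D : GraphDrawing G, D.IsPlanar

/-- On `[0, 1]`, the curve is a constant speed parametrization of a nondegenerate straight line segment,
or of an arc (of angle `|β|`, less than a full turn) of a circle with positive radius. -/
def IsCircularArc (γ : ℝ → ℂ) : Prop :=
  (∃ p q : ℂ, p ≠ q ∧ EqOn γ (fun t => p + t * (q - p)) (Icc 0 1)) ∨
  (∃ (c : ℂ) (r α β : ℝ), 0 < r ∧ β ≠ 0 ∧ |β| < 2 * Real.pi ∧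
    EqOn γ (fun t => circleMap c r (α + t * β)) (Icc 0 1))

/-- The curve leaves its starting point `γ 0` in the direction of angle `θ`. -/
def LeavesAtAngle (γ : ℝ → ℂ) (θ : ℝ) : Prop :=
  ∃ s : ℝ, 0 < s ∧ HasDerivWithinAt γ (s * Complex.exp (θ * Complex.I)) (Icc 0 1) 0

/-- A Lombardi drawing: all edges are circular arcs or straight segments, and at every vertex the
directions of the `n` incident edges are equally spaced, at multiples of `2π / n` (perfect angular
resolution). -/
structure GraphDrawing.IsLombardi {V : Type*} {G : SimpleGraph V} (D : GraphDrawing G) : Prop where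
  isCircularArc : ∀ d, IsCircularArc (D.curve d)
  angularResolution : ∀ v, ∃ (n : ℕ) (σ : {d : G.Dart // d.fst = v} ≃ Fin n) (θ : ℝ),
    ∀ d : {d : G.Dart // d.fst = v},
      LeavesAtAngle (D.curve d) (θ + 2 * Real.pi * ((σ d : ℕ) : ℝ) / n)

/-- The graph has a planar Lombardi drawing. -/
def HasPlanarLombardiDrawing {V : Type*} (G : SimpleGraph V) : Prop :=
  ∃ D : GraphDrawing G, D.IsPlanar ∧ D.IsLombardi

/-- 2-connectedness: at least three vertices, connected, and without cut vertices. -/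
structure IsTwoConnected {V : Type*} [Fintype V] (G : SimpleGraph V) : Prop where
  card : 3 ≤ Fintype.card V
  connected : G.Connected
  noCutVertex : ∀ v : V, (G.induce {v}ᶜ).Connected

/-- The edges of `G₁₈`. The vertices `a, b, c, d, e, f` are `0, 1, 2, 3, 4, 5`. The vertices `6, …, 11`
span an octahedron (with opposite pairs `{6, 9}`, `{7, 10}`, `{8, 11}`) without its edge `{6, 7}`, and
`12, …, 17` span another such octahedron without its edge `{12, 13}`. -/
def edges18 : List (Fin 18 × Fin 18) :=
  [ -- `a` and `f` are joined to each of `b`, `c`, `d`, `e`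
    (0, 1), (0, 2), (0, 3), (0, 4), (5, 1), (5, 2), (5, 3), (5, 4),
    -- the edges `ce` and `bd`
    (2, 4), (1, 3),
    -- the first octahedron without an edge, attached to `c` and `e`
    (6, 8), (6, 10), (6, 11), (7, 8), (7, 9), (7, 11), (8, 9), (8, 10), (9, 10), (9, 11), (10, 11),
    (2, 6), (4, 7),
    -- the second octahedron without an edge, attached to `b` and `d`
    (12, 14), (12, 16), (12, 17), (13, 14), (13, 15), (13, 17), (14, 15), (14, 16), (15, 16),
    (15, 17), (16, 17), (1, 12), (3, 13)]

/-- The graph `G₁₈`. -/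
def G18 : SimpleGraph (Fin 18) where
  Adj u v := (u, v) ∈ edges18 ∨ (v, u) ∈ edges18
  symm := ⟨fun _ _ h => h.symm⟩
  loopless := ⟨by decide⟩

instance : DecidableRel G18.Adj :=
  fun u v => inferInstanceAs (Decidable ((u, v) ∈ edges18 ∨ (v, u) ∈ edges18))

/-- Coordinates of a straight-line drawing of `G18`. -/
def coord18 : Fin 18 → ℤ × ℤ :=
  ![(0, 30), (4, -1), (-20, 0), (20, 0), (-4, -1), (0, -30), (-16, 2), (-6, 2),
    (-11, 1), (-9, 4), (-12, 3), (-10, 7), (6, 2), (16, 2), (11, 1), (12, 3), (9, 4), (10, 7)]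

/-- Twice the signed area of the triangle with the given vertices. -/
def orient (p q r : ℤ × ℤ) : ℤ := (q.1 - p.1) * (r.2 - p.2) - (q.2 - p.2) * (r.1 - p.1)

/-- The points `r`, `s` lie weakly on one side of the line `pq`, not both on it. -/
def OneSide (p q r s : ℤ × ℤ) : Prop :=
  0 ≤ orient p q r * orient p q s ∧ (orient p q r ≠ 0 ∨ orient p q s ≠ 0)

instance (p q r s : ℤ × ℤ) : Decidable (OneSide p q r s) := by unfold OneSide; infer_instance

theorem orient_coord18_ne_zero : ∀ x ∈ edges18, ∀ v : Fin 18, v ≠ x.1 → v ≠ x.2 →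
    orient (coord18 x.1) (coord18 x.2) (coord18 v) ≠ 0 := by
  decide +kernel

theorem oneSide_coord18 : ∀ x ∈ edges18, ∀ y ∈ edges18, x ≠ y →
    OneSide (coord18 x.1) (coord18 x.2) (coord18 y.1) (coord18 y.2) ∨
    OneSide (coord18 y.1) (coord18 y.2) (coord18 x.1) (coord18 x.2) := by
  decide +kernel

theorem coord18_injective : Function.Injective coord18 := by decide +kernel

theorem G18_regular : G18.IsRegularOfDegree 4 := by
  unfold SimpleGraph.IsRegularOfDegree; decide +kernel

/-- One round of breadth-first search in `G18` avoiding the vertex `v`. -/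
def grow18 (v : Fin 18) (S : Finset (Fin 18)) : Finset (Fin 18) :=
  Finset.univ.filter fun w => w ≠ v ∧ (w ∈ S ∨ ∃ u ∈ S, G18.Adj u w)

theorem grow18_eq : ∀ v : Fin 18, (grow18 v)^[8] {if v = 0 then 1 else 0} = Finset.univ.erase v := by
  decide +kernel

theorem reachable_of_mem_grow18 (v r : Fin 18) (hr : r ≠ v) (n : ℕ) :
    ∀ w ∈ (grow18 v)^[n] {r}, ∃ hw : w ≠ v,
      (G18.induce {v}ᶜ).Reachable ⟨r, hr⟩ ⟨w, hw⟩ := by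
  induction n with
  | zero =>
    intro w hw
    obtain rfl : w = r := by simpa using hw
    exact ⟨hr, .refl _⟩
  | succ n ih =>
    intro w hw
    rw [Function.iterate_succ_apply', grow18, Finset.mem_filter] at hw
    obtain ⟨-, hwv, hw | ⟨u, hu, huw⟩⟩ := hw
    · exact ih w hw
    · obtain ⟨huv, hu⟩ := ih u hu
      refine ⟨hwv, hu.trans (SimpleGraph.Adj.reachable ?_)⟩
      simpa using huw

theorem G18_induce_connected (v : Fin 18) : (G18.induce {v}ᶜ).Connected := by
  have hr : (if v = 0 then 1 else 0 : Fin 18) ≠ v := by revert v; decide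
  have key : ∀ w : ({v}ᶜ : Set (Fin 18)), (G18.induce {v}ᶜ).Reachable ⟨_, hr⟩ w := by
    rintro ⟨w, hw⟩
    refine (reachable_of_mem_grow18 v _ hr 8 w ?_).2
    rw [grow18_eq]
    simpa using hw
  exact { preconnected := fun x y => (key x).symm.trans (key y), nonempty := ⟨⟨_, hr⟩⟩ }

theorem G18_connected : G18.Connected := by
  refine { preconnected := fun u w => ?_, nonempty := ⟨0⟩ }
  obtain ⟨v, hu, hw⟩ : ∃ v, u ≠ v ∧ w ≠ v := by revert u w; decide
  have h := (G18_induce_connected v).preconnected ⟨u, hu⟩ ⟨w, hw⟩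
  exact h.map (SimpleGraph.Embedding.induce _).toHom

theorem G18_twoConnected : IsTwoConnected G18 :=
  ⟨by simp, G18_connected, G18_induce_connected⟩

theorem orient_swap (p q r : ℤ × ℤ) : orient q p r = -orient p q r := by
  unfold orient; ring

theorem OneSide.swap_left {p q r s : ℤ × ℤ} (h : OneSide p q r s) : OneSide q p r s := by
  simpa only [OneSide, orient_swap p q, neg_mul_neg, ne_eq, neg_eq_zero] using h

theorem OneSide.swap_right {p q r s : ℤ × ℤ} (h : OneSide p q r s) : OneSide p q s r := by
  unfold OneSide at *; rwa [mul_comm, or_comm]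

theorem oneSide_of_adj {u v u' v' : Fin 18} (h : G18.Adj u v) (h' : G18.Adj u' v')
    (hne : s(u, v) ≠ s(u', v')) :
    OneSide (coord18 u) (coord18 v) (coord18 u') (coord18 v') ∨
    OneSide (coord18 u') (coord18 v') (coord18 u) (coord18 v) := by
  have aux : ∀ {p q r s : Fin 18}, (p, q) ∈ edges18 → (r, s) ∈ edges18 → s(p, q) ≠ s(r, s) →
      OneSide (coord18 p) (coord18 q) (coord18 r) (coord18 s) ∨
      OneSide (coord18 r) (coord18 s) (coord18 p) (coord18 q) := fun {p q r s} hx hy hxy =>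
    oneSide_coord18 (p, q) hx (r, s) hy fun h => hxy (congrArg (fun x => s(x.1, x.2)) h)
  rcases h with h | h <;> rcases h' with h' | h'
  · exact aux h h' hne
  · have := aux h h' (by rwa [Sym2.eq_swap (a := v')])
    exact this.imp OneSide.swap_right OneSide.swap_left
  · have := aux h h' (by rwa [Sym2.eq_swap (a := v)])
    exact this.imp OneSide.swap_left OneSide.swap_right
  · have := aux h h' (by rwa [Sym2.eq_swap (a := v), Sym2.eq_swap (a := v')])
    exact this.imp (fun h => h.swap_left.swap_right) (fun h => h.swap_left.swap_right)

theorem orient_ne_zero_of_adj {u v w : Fin 18} (h : G18.Adj u v) (hu : w ≠ u) (hv : w ≠ v) :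
    orient (coord18 u) (coord18 v) (coord18 w) ≠ 0 := by
  rcases h with h | h
  · exact orient_coord18_ne_zero _ h w hu hv
  · rw [orient_swap, neg_ne_zero]
    exact orient_coord18_ne_zero _ h w hv hu

/-- The point of the plane with the given integer coordinates. -/
def latticePoint (p : ℤ × ℤ) : ℂ := ⟨p.1, p.2⟩

theorem latticePoint_injective : Function.Injective latticePoint := by
  rintro ⟨a, b⟩ ⟨c, d⟩ h
  simpa [latticePoint, Complex.ext_iff] using h

/-- Real-valued version of `orient`, with a point of the plane as last argument. -/
def planeOrient (p q : ℤ × ℤ) (z : ℂ) : ℝ :=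
  (q.1 - p.1) * (z.im - p.2) - (q.2 - p.2) * (z.re - p.1)

theorem planeOrient_latticePoint (p q r : ℤ × ℤ) :
    planeOrient p q (latticePoint r) = orient p q r := by
  simp [planeOrient, orient, latticePoint]

theorem planeOrient_segment (p q r s : ℤ × ℤ) (t : ℝ) :
    planeOrient p q (latticePoint r + t * (latticePoint s - latticePoint r)) =
      (1 - t) * orient p q r + t * orient p q s := by
  simp [planeOrient, orient, latticePoint]; ring

theorem OneSide.segment_ne {p q r s : ℤ × ℤ} (h : OneSide p q r s) {t t' : ℝ}
    (ht : t ∈ Ioo (0 : ℝ) 1) :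
    latticePoint r + t * (latticePoint s - latticePoint r) ≠
      latticePoint p + t' * (latticePoint q - latticePoint p) := by
  intro heq
  have h1 := congrArg (planeOrient p q) heq
  rw [planeOrient_segment, planeOrient_segment] at h1
  have hp : orient p q p = 0 := by simp [orient]
  have hq : orient p q q = 0 := by simp only [orient]; ring
  rw [hp, hq] at h1
  obtain ⟨h2, h3⟩ := h
  have h2' : (0 : ℝ) ≤ orient p q r * orient p q s := by exact_mod_cast h2
  have h3' : (orient p q r : ℝ) ≠ 0 ∨ (orient p q s : ℝ) ≠ 0 := by exact_mod_cast h3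
  generalize (orient p q r : ℝ) = x at *
  generalize (orient p q s : ℝ) = y at *
  obtain ⟨ht0, ht1⟩ := ht
  have e : (1 - t) * (1 - t) * (x * x) + t * t * (y * y) + 2 * (1 - t) * t * (x * y) = 0 := by
    have : ((1 - t) * x + t * y) ^ 2 = 0 := by rw [h1]; simp
    linarith [this]
  have p1 : 0 < (1 - t) * (1 - t) := mul_pos (by linarith) (by linarith)
  have p2 : 0 < t * t := mul_pos ht0 ht0
  have p3 : 0 ≤ 2 * (1 - t) * t * (x * y) :=
    mul_nonneg (mul_nonneg (by linarith) ht0.le) h2'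
  rcases h3' with hx | hy
  · have := mul_pos p1 (mul_self_pos.2 hx)
    have := mul_nonneg p2.le (mul_self_nonneg y)
    linarith
  · have := mul_pos p2 (mul_self_pos.2 hy)
    have := mul_nonneg p1.le (mul_self_nonneg x)
    linarith

/-- The straight-line drawing of `G18` with vertices at `coord18`. -/
noncomputable def drawing18 : GraphDrawing G18 where
  pos v := latticePoint (coord18 v)
  pos_injective := latticePoint_injective.comp coord18_injective
  curve d t := latticePoint (coord18 d.fst) +
    t * (latticePoint (coord18 d.snd) - latticePoint (coord18 d.fst))
  continuousOn_curve d := by fun_prop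
  curve_zero d := by simp
  curve_one d := by simp
  curve_symm d t _ := by simp [SimpleGraph.Dart.symm]; ring

theorem G18_isPlanarGraph : IsPlanarGraph G18 := by
  refine ⟨drawing18, ?_, ?_, ?_⟩
  · intro d t _ t' _ h
    have hne : latticePoint (coord18 d.snd) - latticePoint (coord18 d.fst) ≠ 0 :=
      sub_ne_zero.2 fun h => d.adj.ne (coord18_injective (latticePoint_injective h)).symm
    have h' := mul_right_cancel₀ hne (add_left_cancel h)
    exact_mod_cast h'
  · intro d t ht v h
    have horient := congrArg (planeOrient (coord18 d.fst) (coord18 d.snd)) h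
    simp only [drawing18] at horient h
    rw [planeOrient_segment, planeOrient_latticePoint] at horient
    have hne : latticePoint (coord18 d.snd) - latticePoint (coord18 d.fst) ≠ 0 :=
      sub_ne_zero.2 fun h => d.adj.ne (coord18_injective (latticePoint_injective h)).symm
    have hp : orient (coord18 d.fst) (coord18 d.snd) (coord18 d.fst) = 0 := by simp [orient]
    have hq : orient (coord18 d.fst) (coord18 d.snd) (coord18 d.snd) = 0 := by
      simp only [orient]; ring
    rw [hp, hq] at horient
    have hzero : orient (coord18 d.fst) (coord18 d.snd) (coord18 v) = 0 := by
      have := horient.symm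
      simp only [Int.cast_zero, mul_zero, add_zero] at this
      exact_mod_cast this
    refine orient_ne_zero_of_adj d.adj ?_ ?_ hzero
    · rintro rfl
      have : (t : ℂ) = 0 := by simpa [hne] using h
      exact ht.1.ne' (by exact_mod_cast this)
    · rintro rfl
      have : ((1 - t : ℝ) : ℂ) * (latticePoint (coord18 d.snd) - latticePoint (coord18 d.fst)) = 0 := by
        push_cast; linear_combination -h
      have : ((1 - t : ℝ) : ℂ) = 0 := by simpa only [mul_eq_zero, hne, or_false] using this
      have : 1 - t = 0 := by exact_mod_cast this
      linarith [ht.2]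
  · intro d d' hne t ht t' ht' h
    rcases oneSide_of_adj d.adj d'.adj hne with h1 | h1
    · exact h1.segment_ne ht' h.symm
    · exact h1.segment_ne ht h

theorem exp_two_mul_sub_one (x : ℂ) : Complex.exp (2 * x * Complex.I) - 1 =
    2 * Complex.I * Complex.exp (x * Complex.I) * Complex.sin x := by
  rw [Complex.sin, show 2 * x * Complex.I = x * Complex.I + x * Complex.I by ring, Complex.exp_add,
    show -x * Complex.I = -(x * Complex.I) by ring, Complex.exp_neg]
  have := Complex.exp_ne_zero (x * Complex.I)
  field_simp
  rw [Complex.I_sq]; ring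

theorem one_add_mul_exp_ne_zero {b x : ℝ} (hb : |b| < Real.pi) (hx : 0 < x) :
    1 + x * Complex.exp (b * Complex.I) ≠ 0 := by
  intro h
  obtain ⟨hb1, hb2⟩ := abs_lt.1 hb
  have hre := congrArg Complex.re h
  have him := congrArg Complex.im h
  simp [Complex.exp_ofReal_mul_I_re, Complex.exp_ofReal_mul_I_im] at hre him
  rcases him with h0 | h0
  · exact hx.ne' h0
  · have := (Real.sin_eq_zero_iff_of_lt_of_lt hb1 hb2).1 h0
    subst this
    simp at hre
    linarith

theorem sin_div_sin_pos {b t : ℝ} (hb : |b| < Real.pi) (hb0 : b ≠ 0) (ht : t ∈ Ioo (0 : ℝ) 1) :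
    0 < Real.sin (b * (1 - t)) / Real.sin (t * b) := by
  obtain ⟨hb1, hb2⟩ := abs_lt.1 hb
  obtain ⟨ht0, ht1⟩ := ht
  rcases hb0.lt_or_gt with h | h
  · apply div_pos_of_neg_of_neg <;> apply Real.sin_neg_of_neg_of_neg_pi_lt <;> nlinarith
  · apply div_pos <;> apply Real.sin_pos_of_pos_of_lt_pi <;> nlinarith

theorem exists_sin_ratio {b l : ℝ} (hb : |b| < Real.pi) (hb0 : b ≠ 0) (hl : 0 < l) :
    ∃ t ∈ Ioo (0 : ℝ) 1, Real.sin (b * (1 - t)) = l * Real.sin (t * b) := by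
  obtain ⟨hb1, hb2⟩ := abs_lt.1 hb
  have hc : ContinuousOn (fun t : ℝ => Real.sin (b * (1 - t)) - l * Real.sin (t * b))
      (Icc 0 1) := by fun_prop
  rcases hb0.lt_or_gt with h | h
  · have hs : Real.sin b < 0 := Real.sin_neg_of_neg_of_neg_pi_lt h hb1
    obtain ⟨t, ht, h0⟩ := intermediate_value_Ioo zero_le_one hc
      (show (0 : ℝ) ∈ Ioo _ _ from ⟨by simpa using hs, by simp; nlinarith⟩)
    exact ⟨t, ht, sub_eq_zero.1 h0⟩
  · have hs : 0 < Real.sin b := Real.sin_pos_of_pos_of_lt_pi h hb2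
    obtain ⟨t, ht, h0⟩ := intermediate_value_Ioo' zero_le_one hc
      (show (0 : ℝ) ∈ Ioo _ _ from ⟨by simp; nlinarith, by simpa using hs⟩)
    exact ⟨t, ht, sub_eq_zero.1 h0⟩

/-- A circular arc from `p` to `q` that spans the angle `2b` consists of the points `z` such that
`(q - z) / (z - p)` is a positive multiple of `exp (b * I)`. -/
theorem IsCircularArc.exists_halfAngle {γ : ℝ → ℂ} {p q : ℂ} {θ : ℝ} (h : IsCircularArc γ)
    (h0 : γ 0 = p) (h1 : γ 1 = q) (hθ : LeavesAtAngle γ θ) :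
    ∃ b : ℝ, |b| < Real.pi ∧
      (∃ r : ℝ, 0 < r ∧ Complex.exp (θ * Complex.I) * Complex.exp (b * Complex.I) = r * (q - p)) ∧
      (∀ t ∈ Ioo (0 : ℝ) 1, ∃ l : ℝ, 0 < l ∧
        q - γ t = l * Complex.exp (b * Complex.I) * (γ t - p)) ∧
      (∀ l : ℝ, 0 < l → ∃ t ∈ Ioo (0 : ℝ) 1,
        q - γ t = l * Complex.exp (b * Complex.I) * (γ t - p)) := by
  obtain ⟨s, hs, hd⟩ := hθ
  have z0 : (0 : ℝ) ∈ Icc (0 : ℝ) 1 := by simp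
  have z1 : (1 : ℝ) ∈ Icc (0 : ℝ) 1 := by simp
  have hu : UniqueDiffWithinAt ℝ (Icc (0 : ℝ) 1) 0 := uniqueDiffOn_Icc zero_lt_one 0 z0
  have hsC : (s : ℂ) ≠ 0 := by exact_mod_cast hs.ne'
  rcases h with ⟨p', q', hpq, hγ⟩ | ⟨c, r, α, β, hr, hβ, hβ2, hγ⟩
  · obtain rfl : p' = p := by rw [← h0, hγ z0]; simp
    obtain rfl : q' = q := by rw [← h1, hγ z1]; simp
    refine ⟨0, by simpa using Real.pi_pos, ⟨s⁻¹, by positivity, ?_⟩, ?_, ?_⟩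
    · have hd' : HasDerivWithinAt (fun t : ℝ => p' + (t : ℂ) * (q' - p')) (q' - p') (Icc 0 1) 0 := by
        have := ((Complex.ofRealCLM.hasDerivAt (x := (0 : ℝ))).mul_const (q' - p')).const_add p'
        simpa using this.hasDerivWithinAt
      have := hu.eq_deriv _ hd (hd'.congr hγ (hγ z0))
      rw [← this]
      push_cast
      field_simp
      simp
    · rintro t ⟨ht0, ht1⟩
      refine ⟨(1 - t) / t, div_pos (by linarith) ht0, ?_⟩
      have htC : (t : ℂ) ≠ 0 := by exact_mod_cast ht0.ne'
      rw [hγ ⟨ht0.le, ht1.le⟩]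
      push_cast
      simp
      field_simp
      ring
    · intro l hl
      have hlC : (1 + l : ℂ) ≠ 0 := by exact_mod_cast (by linarith : (1 + l : ℝ) ≠ 0)
      have ht : 1 / (1 + l) ∈ Ioo (0 : ℝ) 1 :=
        ⟨by positivity, by rw [div_lt_one (by linarith)]; linarith⟩
      refine ⟨1 / (1 + l), ht, ?_⟩
      rw [hγ ⟨ht.1.le, ht.2.le⟩]
      push_cast
      simp
      field_simp
      ring
  · set b : ℝ := β / 2 with hbdef
    have hb : |b| < Real.pi := by
      rw [hbdef, abs_div, abs_two]; linarith
    have hb0 : b ≠ 0 := by rw [hbdef]; positivity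
    have hβb : β = 2 * b := by rw [hbdef]; ring
    obtain ⟨hb1, hb2⟩ := abs_lt.1 hb
    have hsinb : Real.sin b ≠ 0 := fun h => hb0 ((Real.sin_eq_zero_iff_of_lt_of_lt hb1 hb2).1 h)
    have hrC : (r : ℂ) ≠ 0 := by exact_mod_cast hr.ne'
    set E := Complex.exp (α * Complex.I) with hE
    have hval : ∀ t ∈ Icc (0 : ℝ) 1, γ t = c + r * (E * Complex.exp (2 * (t * b) * Complex.I)) := by
      intro t ht
      rw [hγ ht]
      simp only [circleMap]
      rw [hE, ← Complex.exp_add, hβb]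
      push_cast
      ring_nf
    have hp : p = c + r * E := by rw [← h0, hval 0 z0]; simp
    have hzp : ∀ t ∈ Icc (0 : ℝ) 1, γ t - p = r * E *
        (2 * Complex.I * Complex.exp (t * b * Complex.I) * Complex.sin (t * b)) := by
      intro t ht
      rw [← exp_two_mul_sub_one, hval t ht, hp]; ring
    have hqz : ∀ t ∈ Icc (0 : ℝ) 1, q - γ t = r * E * Complex.exp (2 * (t * b) * Complex.I) *
        (2 * Complex.I * Complex.exp (b * (1 - t) * Complex.I) * Complex.sin (b * (1 - t))) := by
      intro t ht
      have h3 : Complex.exp (2 * (t * b) * Complex.I) * Complex.exp (2 * (b * (1 - t)) * Complex.I) =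
          Complex.exp (2 * (((1 : ℝ) : ℂ) * b) * Complex.I) := by
        rw [← Complex.exp_add]; push_cast; ring_nf
      rw [← exp_two_mul_sub_one, hval t ht, ← h1, hval 1 z1]
      linear_combination (-r * E) * h3
    have hrel : ∀ t ∈ Icc (0 : ℝ) 1, (q - γ t) * (Real.sin (t * b) : ℂ) =
        Real.sin (b * (1 - t)) * Complex.exp (b * Complex.I) * (γ t - p) := by
      intro t ht
      rw [hzp t ht, hqz t ht]
      have : Complex.exp (2 * (t * b) * Complex.I) * Complex.exp (b * (1 - t) * Complex.I) =
          Complex.exp (b * Complex.I) * Complex.exp (t * b * Complex.I) := by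
        rw [← Complex.exp_add, ← Complex.exp_add]; ring_nf
      push_cast
      linear_combination (r * E * 2 * Complex.I * Complex.sin (b * (1 - t)) *
        Complex.sin (t * b)) * this
    refine ⟨b, hb, ⟨β / (2 * s * Real.sin b), ?_, ?_⟩, ?_, ?_⟩
    · have : 0 < b / Real.sin b := by
        rcases hb0.lt_or_gt with h | h
        · exact div_pos_of_neg_of_neg h (Real.sin_neg_of_neg_of_neg_pi_lt h hb1)
        · exact div_pos h (Real.sin_pos_of_pos_of_lt_pi h hb2)
      have h2 : β / (2 * s * Real.sin b) = (b / Real.sin b) / s := by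
        rw [hβb]; field_simp
      rw [h2]; positivity
    · have hd' : HasDerivWithinAt (fun t : ℝ => circleMap c r (α + t * β))
          (r * E * Complex.I * β) (Icc 0 1) 0 := by
        have h3 : HasDerivAt (fun t : ℝ => α + t * β) β 0 := by
          simpa using ((hasDerivAt_id (0 : ℝ)).mul_const β).const_add α
        have := (hasDerivAt_circleMap c r (α + 0 * β)).scomp (0 : ℝ) h3
        refine (this.congr_deriv ?_).hasDerivWithinAt
        simp [circleMap, hE]; ring
      have hder := hu.eq_deriv _ hd (hd'.congr hγ (hγ z0))
      have hqp := hzp 1 z1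
      rw [h1] at hqp
      simp only [Complex.ofReal_one, one_mul] at hqp
      have hsinC : Complex.sin (b : ℂ) ≠ 0 := by exact_mod_cast hsinb
      rw [hqp]
      push_cast
      field_simp
      linear_combination hder
    · intro t ht
      have hpos := sin_div_sin_pos hb hb0 ht
      refine ⟨_, hpos, ?_⟩
      have hne : (Real.sin (t * b) : ℂ) ≠ 0 := by
        have : Real.sin (t * b) ≠ 0 := fun h => by rw [h, div_zero] at hpos; exact hpos.false
        exact_mod_cast this
      have := hrel t ⟨ht.1.le, ht.2.le⟩
      rw [Complex.ofReal_div]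
      apply mul_right_cancel₀ hne
      have hcancel := div_mul_cancel₀ (Real.sin (b * (1 - t)) : ℂ) hne
      linear_combination this - (Complex.exp (b * Complex.I) * (γ t - p)) * hcancel
    · intro l hl
      obtain ⟨t, ht, hlt⟩ := exists_sin_ratio hb hb0 hl
      refine ⟨t, ht, ?_⟩
      have hpos := sin_div_sin_pos hb hb0 ht
      have hne : (Real.sin (t * b) : ℂ) ≠ 0 := by
        have : Real.sin (t * b) ≠ 0 := fun h => by rw [h, div_zero] at hpos; exact hpos.false
        exact_mod_cast this
      have := hrel t ⟨ht.1.le, ht.2.le⟩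
      rw [hlt] at this
      apply mul_right_cancel₀ hne
      rw [this]
      push_cast
      ring

/-- The open circular arc from `p` to `q` that leaves `p` in the direction of `u`. -/
def openArc (p q u : ℂ) : Set ℂ :=
  {z | ∃ r : ℝ, 0 < r ∧ (q - z) * u = r * ((z - p) * (q - p))}

theorem IsCircularArc.image_eq_openArc {γ : ℝ → ℂ} {p q : ℂ} {θ : ℝ} (h : IsCircularArc γ)
    (h0 : γ 0 = p) (h1 : γ 1 = q) (hpq : p ≠ q) (hθ : LeavesAtAngle γ θ) :
    γ '' Ioo 0 1 = openArc p q (Complex.exp (θ * Complex.I)) := by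
  obtain ⟨b, hb, ⟨r, hr, hu⟩, hin, hsurj⟩ := h.exists_halfAngle h0 h1 hθ
  have hqp : q - p ≠ 0 := sub_ne_zero.2 hpq.symm
  have hrC : (r : ℂ) ≠ 0 := by exact_mod_cast hr.ne'
  have hexp := Complex.exp_ne_zero (b * Complex.I)
  ext z
  constructor
  · rintro ⟨t, ht, rfl⟩
    obtain ⟨l, hl, h⟩ := hin t ht
    refine ⟨l * r, by positivity, ?_⟩
    rw [h]
    push_cast
    linear_combination (l * (γ t - p)) * hu
  · rintro ⟨l, hl, h⟩
    obtain ⟨t, ht, h2⟩ := hsurj (l / r) (by positivity)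
    refine ⟨t, ht, ?_⟩
    have h3 : q - z = ((l / r : ℝ) : ℂ) * Complex.exp (b * Complex.I) * (z - p) := by
      apply mul_right_cancel₀ (mul_ne_zero hqp hrC)
      have hcancel := div_mul_cancel₀ (l : ℂ) hrC
      push_cast
      linear_combination Complex.exp (b * Complex.I) * h - (q - z) * hu -
        Complex.exp (b * Complex.I) * (z - p) * (q - p) * hcancel
    have h4 : (γ t - z) * (1 + ((l / r : ℝ) : ℂ) * Complex.exp (b * Complex.I)) = 0 := by
      linear_combination h3 - h2
    exact sub_eq_zero.1 ((mul_eq_zero.1 h4).resolve_right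
      (one_add_mul_exp_ne_zero hb (by positivity)))

theorem IsCircularArc.direction_ne {γ : ℝ → ℂ} {p q : ℂ} {θ : ℝ} (h : IsCircularArc γ)
    (h0 : γ 0 = p) (h1 : γ 1 = q) (hpq : p ≠ q) (hθ : LeavesAtAngle γ θ) (r : ℝ) (hr : 0 < r) :
    Complex.exp (θ * Complex.I) ≠ r * (p - q) := by
  intro hcon
  obtain ⟨b, hb, ⟨s, hs, hu⟩, -, -⟩ := h.exists_halfAngle h0 h1 hθ
  have hqp : q - p ≠ 0 := sub_ne_zero.2 hpq.symm
  have hsC : (s : ℂ) ≠ 0 := by exact_mod_cast hs.ne'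
  refine one_add_mul_exp_ne_zero hb (div_pos hr hs) (mul_right_cancel₀ (mul_ne_zero hqp hsC) ?_)
  rw [hcon] at hu
  have hcancel := div_mul_cancel₀ (r : ℂ) hsC
  push_cast
  linear_combination -hu + Complex.exp (b * Complex.I) * (q - p) * hcancel

/-- The data of a planar Lombardi drawing of a graph all of whose vertices have degree four: the
edge from `v` to `w` leaves `v` in the direction `dir v w`, which is obtained from the direction
`base v` by `rot v w` quarter turns. -/
structure RightAngleDrawing {V : Type*} (G : SimpleGraph V) where
  pos : V → ℂ
  pos_injective : Function.Injective pos
  base : V → ℂ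
  base_ne_zero : ∀ v, base v ≠ 0
  rot : V → V → ZMod 4
  rot_inj : ∀ {v w w'}, G.Adj v w → G.Adj v w' → rot v w = rot v w' → w = w'
  dir : V → V → ℂ
  dir_eq : ∀ {v w}, G.Adj v w → dir v w = base v * Complex.I ^ (rot v w).val
  curve : V → V → ℝ → ℂ
  continuousOn_curve : ∀ {v w}, G.Adj v w → ContinuousOn (curve v w) (Icc 0 1)
  curve_zero : ∀ {v w}, G.Adj v w → curve v w 0 = pos v
  curve_symm : ∀ {v w}, G.Adj v w → ∀ t ∈ Icc (0 : ℝ) 1, curve w v t = curve v w (1 - t)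
  hasDerivWithinAt_curve : ∀ {v w}, G.Adj v w →
    ∃ s : ℝ, 0 < s ∧ HasDerivWithinAt (curve v w) (s * dir v w) (Icc 0 1) 0
  image_curve : ∀ {v w}, G.Adj v w → curve v w '' Ioo 0 1 = openArc (pos v) (pos w) (dir v w)
  dir_ne : ∀ {v w}, G.Adj v w → ∀ r : ℝ, 0 < r → dir v w ≠ r * (pos v - pos w)
  pos_notMem : ∀ {v w}, G.Adj v w → ∀ x, pos x ∉ openArc (pos v) (pos w) (dir v w)
  disjoint : ∀ {v w v' w'}, G.Adj v w → G.Adj v' w' → s(v, w) ≠ s(v', w') →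
    Disjoint (openArc (pos v) (pos w) (dir v w)) (openArc (pos v') (pos w') (dir v' w'))

theorem exp_add_quarter_turns (θ : ℝ) (m : ℕ) :
    Complex.exp ((θ + 2 * Real.pi * (m : ℝ) / (4 : ℕ) : ℝ) * Complex.I) =
      Complex.exp (θ * Complex.I) * Complex.I ^ m := by
  have : ((θ + 2 * Real.pi * (m : ℝ) / (4 : ℕ) : ℝ) : ℂ) * Complex.I =
      θ * Complex.I + m * (Real.pi / 2 * Complex.I) := by push_cast; ring
  rw [this, Complex.exp_add, Complex.exp_nat_mul, Complex.exp_pi_div_two_mul_I]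

theorem GraphDrawing.exists_rightAngleDrawing {V : Type*} [Fintype V] {G : SimpleGraph V}
    [DecidableRel G.Adj] (hG : G.IsRegularOfDegree 4) (D : GraphDrawing G) (hP : D.IsPlanar)
    (hL : D.IsLombardi) : Nonempty (RightAngleDrawing G) := by
  classical
  have hrot : ∀ v, ∃ (σ : {d : G.Dart // d.fst = v} → ZMod 4) (θ : ℝ), Function.Injective σ ∧
      ∀ d : {d : G.Dart // d.fst = v},
        LeavesAtAngle (D.curve d) (θ + 2 * Real.pi * ((σ d).val : ℝ) / (4 : ℕ)) := by
    intro v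
    obtain ⟨n, σ, θ, h⟩ := hL.angularResolution v
    have hn : n = 4 := by
      have h1 := Fintype.card_congr σ
      rw [Fintype.card_fin, Fintype.card_subtype, G.dart_fst_fiber_card_eq_degree, hG v] at h1
      exact h1.symm
    subst hn
    exact ⟨σ, θ, σ.injective, h⟩
  choose σ θ hσ hθ using hrot
  let dart : ∀ v w, G.Adj v w → {d : G.Dart // d.fst = v} := fun v w h => ⟨⟨(v, w), h⟩, rfl⟩
  let curve : V → V → ℝ → ℂ := fun v w => if h : G.Adj v w then D.curve (dart v w h) else 0
  let rot : V → V → ZMod 4 := fun v w => if h : G.Adj v w then σ v (dart v w h) else 0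
  have hcurve : ∀ {v w} (h : G.Adj v w), curve v w = D.curve (dart v w h) :=
    fun h => dif_pos h
  have hrot : ∀ {v w} (h : G.Adj v w), rot v w = σ v (dart v w h) := fun h => dif_pos h
  have hleaves : ∀ {v w} (h : G.Adj v w), LeavesAtAngle (curve v w)
      (θ v + 2 * Real.pi * ((rot v w).val : ℝ) / (4 : ℕ)) := by
    intro v w h
    rw [hcurve h, hrot h]
    exact hθ v (dart v w h)
  have harc : ∀ {v w} (h : G.Adj v w), IsCircularArc (curve v w) := by
    intro v w h
    rw [hcurve h]
    exact hL.isCircularArc _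
  have h0 : ∀ {v w} (h : G.Adj v w), curve v w 0 = D.pos v := by
    intro v w h
    rw [hcurve h]
    exact D.curve_zero _
  have h1 : ∀ {v w} (h : G.Adj v w), curve v w 1 = D.pos w := by
    intro v w h
    rw [hcurve h]
    exact D.curve_one _
  have himage : ∀ {v w} (h : G.Adj v w), curve v w '' Ioo 0 1 = openArc (D.pos v) (D.pos w)
      (Complex.exp (θ v * Complex.I) * Complex.I ^ (rot v w).val) := by
    intro v w h
    rw [(harc h).image_eq_openArc (h0 h) (h1 h) (fun e => h.ne (D.pos_injective e)) (hleaves h),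
      exp_add_quarter_turns]
  refine ⟨{
    pos := D.pos
    pos_injective := D.pos_injective
    base := fun v => Complex.exp (θ v * Complex.I)
    base_ne_zero := fun v => Complex.exp_ne_zero _
    rot := rot
    dir := fun v w => Complex.exp (θ v * Complex.I) * Complex.I ^ (rot v w).val
    curve := curve
    dir_eq := fun _ => rfl
    curve_zero := h0
    image_curve := himage
    rot_inj := ?_, continuousOn_curve := ?_, curve_symm := ?_, hasDerivWithinAt_curve := ?_,
    dir_ne := ?_, pos_notMem := ?_, disjoint := ?_ }⟩
  · intro v w w' h h' he
    rw [hrot h, hrot h'] at he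
    exact congrArg (fun d : {d : G.Dart // d.fst = v} => d.1.snd) (hσ v he)
  · intro v w h
    rw [hcurve h]
    exact D.continuousOn_curve _
  · intro v w h t ht
    rw [hcurve h, hcurve h.symm]
    exact D.curve_symm (dart v w h).1 t ht
  · intro v w h
    obtain ⟨s, hs, hd⟩ := hleaves h
    refine ⟨s, hs, ?_⟩
    rwa [exp_add_quarter_turns] at hd
  · intro v w h r hr
    rw [← exp_add_quarter_turns]
    exact (harc h).direction_ne (h0 h) (h1 h) (fun e => h.ne (D.pos_injective e)) (hleaves h) r hr
  · intro v w h x hx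
    rw [← himage h, hcurve h] at hx
    obtain ⟨t, ht, hx⟩ := hx
    exact hP.avoids_vertices _ t ht x hx
  · intro v w v' w' h h' hne
    rw [← himage h, ← himage h', hcurve h, hcurve h', Set.disjoint_left]
    rintro _ ⟨t, ht, rfl⟩ ⟨t', ht', he⟩
    exact hP.avoids_edges (dart v w h).1 (dart v' w' h').1 hne t ht t' ht' he.symm

theorem I_pow_val_sub_mul (a b : ZMod 4) :
    Complex.I ^ (a - b).val * Complex.I ^ b.val = Complex.I ^ a.val := by
  rw [← pow_add, Complex.I_pow_eq_pow_mod, ← ZMod.val_add, sub_add_cancel]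

theorem neg_I_pow_mem_slitPlane {m : ZMod 4} (hm : m ≠ 0) :
    -Complex.I ^ m.val ∈ Complex.slitPlane ∧
      (-Complex.I ^ m.val).arg = Real.pi / 2 * ((m.val : ℝ) - 2) := by
  have h : m = 1 ∨ m = 2 ∨ m = 3 := by revert m; decide
  rcases h with rfl | rfl | rfl
  · have : (1 : ZMod 4).val = 1 := rfl
    rw [this]
    refine ⟨by simp [Complex.mem_slitPlane_iff], ?_⟩
    rw [pow_one, Complex.arg_neg_I]
    push_cast; ring
  · have : (2 : ZMod 4).val = 2 := rfl
    rw [this]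
    simp [Complex.mem_slitPlane_iff]
  · have : (3 : ZMod 4).val = 3 := rfl
    rw [this]
    have h3 : -Complex.I ^ 3 = Complex.I := by rw [pow_succ, Complex.I_sq]; ring
    rw [h3, Complex.arg_I]
    refine ⟨by simp [Complex.mem_slitPlane_iff], ?_⟩
    push_cast; ring

/-- The complex number whose argument is, up to a constant, the angle under which the arc from `p`
to `q` with direction `u` at `p` is seen from `z`. -/
noncomputable def arcRatio (p q u z : ℂ) : ℂ := (q - z) * u / ((p - z) * (q - p))

theorem arcRatio_mem_slitPlane {p q u z : ℂ} (hp : z ≠ p) (hq : z ≠ q) (hpq : p ≠ q) (hu : u ≠ 0)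
    (hz : z ∉ openArc p q u) : arcRatio p q u z ∈ Complex.slitPlane := by
  have hp' : p - z ≠ 0 := sub_ne_zero.2 hp.symm
  have hq' : q - z ≠ 0 := sub_ne_zero.2 hq.symm
  have hpq' : q - p ≠ 0 := sub_ne_zero.2 hpq.symm
  have hne : arcRatio p q u z ≠ 0 := by
    unfold arcRatio; positivity
  rw [Complex.mem_slitPlane_iff]
  by_contra! h
  have hre : (arcRatio p q u z).re < 0 := lt_of_le_of_ne h.1 fun h0 =>
    hne (Complex.ext h0 h.2)
  refine hz ⟨-(arcRatio p q u z).re, by linarith, ?_⟩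
  have heq : arcRatio p q u z = ((arcRatio p q u z).re : ℂ) := Complex.ext (by simp) (by simp [h.2])
  push_cast
  rw [← heq, arcRatio]
  field_simp
  ring

open Filter Topology

theorem exp_sum_arg_mul_I {ι : Type*} (s : Finset ι) (f : ι → ℂ) (hf : ∀ i ∈ s, f i ≠ 0) :
    Complex.exp ((∑ i ∈ s, (f i).arg : ℝ) * Complex.I) = (∏ i ∈ s, f i) / ‖∏ i ∈ s, f i‖ := by
  have h : ∀ i ∈ s, Complex.exp ((f i).arg * Complex.I) = f i / ‖f i‖ := by
    intro i hi
    have h0 : ((‖f i‖ : ℝ) : ℂ) ≠ 0 := by simpa using hf i hi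
    rw [eq_div_iff h0, mul_comm]
    exact Complex.norm_mul_exp_arg_mul_I (f i)
  rw [Complex.ofReal_sum, Finset.sum_mul, Complex.exp_sum, Finset.prod_congr rfl h,
    Finset.prod_div_distrib, norm_prod, Complex.ofReal_prod]

/-- A continuous real function on an interval is constant if its values are constant modulo `2π`. -/
theorem eq_of_exp_mul_I_eq {f : ℝ → ℝ} {C : ℂ} (hf : ContinuousOn f (Ioo 0 1))
    (hC : ∀ t ∈ Ioo (0 : ℝ) 1, Complex.exp (f t * Complex.I) = C) :
    ∀ t ∈ Ioo (0 : ℝ) 1, ∀ t' ∈ Ioo (0 : ℝ) 1, f t = f t' := by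
  have key : ∀ t ∈ Ioo (0 : ℝ) 1, ∀ t' ∈ Ioo (0 : ℝ) 1, ¬ f t < f t' := by
    intro t ht t' ht' hlt
    have himg : (f '' Ioo 0 1).OrdConnected := (isPreconnected_Ioo.image f hf).ordConnected
    set δ := min (f t' - f t) 1 with hδ
    have hδ0 : 0 < δ := lt_min (by linarith) one_pos
    obtain ⟨t'', ht'', he⟩ := himg.out (mem_image_of_mem f ht) (mem_image_of_mem f ht')
      (show f t + δ ∈ Icc (f t) (f t') from
        ⟨by linarith, by linarith [min_le_left (f t' - f t) 1]⟩)
    have h1 := (hC t'' ht'').trans (hC t ht).symm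
    rw [he, Complex.exp_eq_exp_iff_exists_int] at h1
    obtain ⟨n, hn⟩ := h1
    have h2 : (δ : ℂ) * Complex.I = ((n * (2 * Real.pi) : ℝ) : ℂ) * Complex.I := by
      push_cast at hn ⊢
      linear_combination hn
    have h3 : δ = n * (2 * Real.pi) := by exact_mod_cast mul_right_cancel₀ Complex.I_ne_zero h2
    have hδ1 : δ ≤ 1 := min_le_right _ _
    have hpi := Real.pi_gt_three
    rcases le_or_gt n 0 with hn0 | hn0
    · have : (n : ℝ) ≤ 0 := by exact_mod_cast hn0
      nlinarith
    · have : (1 : ℝ) ≤ n := by exact_mod_cast hn0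
      nlinarith
  intro t ht t' ht'
  exact le_antisymm (not_lt.1 (key t' ht' t ht)) (not_lt.1 (key t ht t' ht'))

namespace RightAngleDrawing

variable {V : Type*} {G : SimpleGraph V} (D : RightAngleDrawing G)

theorem dir_ne_zero {v w : V} (h : G.Adj v w) : D.dir v w ≠ 0 := by
  rw [D.dir_eq h]
  exact mul_ne_zero (D.base_ne_zero v) (pow_ne_zero _ Complex.I_ne_zero)

theorem pos_ne {v w : V} (h : v ≠ w) : D.pos v ≠ D.pos w := D.pos_injective.ne h

theorem dir_eq_mul {v w w' : V} (h : G.Adj v w) (h' : G.Adj v w') :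
    D.dir v w = Complex.I ^ (D.rot v w - D.rot v w').val * D.dir v w' := by
  rw [D.dir_eq h, D.dir_eq h', ← I_pow_val_sub_mul (D.rot v w) (D.rot v w')]
  ring

theorem rot_sub_ne_zero {v w w' : V} (h : G.Adj v w) (h' : G.Adj v w') (hne : w ≠ w') :
    D.rot v w - D.rot v w' ≠ 0 :=
  sub_ne_zero.2 fun he => hne (D.rot_inj h h' he)

theorem curve_mem_openArc {v w : V} (h : G.Adj v w) {t : ℝ} (ht : t ∈ Ioo (0 : ℝ) 1) :
    D.curve v w t ∈ openArc (D.pos v) (D.pos w) (D.dir v w) := by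
  rw [← D.image_curve h]
  exact mem_image_of_mem _ ht

theorem curve_ne_pos {v w : V} (h : G.Adj v w) {t : ℝ} (ht : t ∈ Ioo (0 : ℝ) 1) (x : V) :
    D.curve v w t ≠ D.pos x := fun he =>
  D.pos_notMem h x (he ▸ D.curve_mem_openArc h ht)

theorem dir_mul_dir {v w : V} (h : G.Adj v w) :
    ∃ r : ℝ, 0 < r ∧ D.dir v w * D.dir w v = -(r * (D.pos w - D.pos v) ^ 2) := by
  have ht : (1 / 2 : ℝ) ∈ Ioo (0 : ℝ) 1 := by norm_num
  have h1 := D.curve_mem_openArc h ht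
  have h2 := D.curve_mem_openArc h.symm ht
  have hv := sub_ne_zero.2 (D.curve_ne_pos h ht v)
  have hw := sub_ne_zero.2 (D.curve_ne_pos h ht w).symm
  rw [D.curve_symm h _ ⟨by norm_num, by norm_num⟩,
    show (1 - 1 / 2 : ℝ) = 1 / 2 by norm_num] at h2
  obtain ⟨r, hr, h1⟩ := h1
  obtain ⟨r', hr', h2⟩ := h2
  refine ⟨r * r', by positivity, ?_⟩
  generalize D.curve v w (1 / 2) = z at *
  apply mul_right_cancel₀ (mul_ne_zero hv hw)
  push_cast
  linear_combination (-(D.pos v - z) * D.dir w v) * h1 -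
    (r * (z - D.pos v) * (D.pos w - D.pos v)) * h2

/-- The angle under which the edge from `v` to `w` is seen from `z`, up to a constant. -/
noncomputable def viewArg (v w : V) (z : ℂ) : ℝ :=
  (arcRatio (D.pos v) (D.pos w) (D.dir v w) z).arg

theorem arcRatio_curve_mem_slitPlane {v w x y : V} (h : G.Adj v w) (h' : G.Adj x y)
    (hne : s(v, w) ≠ s(x, y)) {t : ℝ} (ht : t ∈ Ioo (0 : ℝ) 1) :
    arcRatio (D.pos v) (D.pos w) (D.dir v w) (D.curve x y t) ∈ Complex.slitPlane :=
  arcRatio_mem_slitPlane (D.curve_ne_pos h' ht v) (D.curve_ne_pos h' ht w) (D.pos_ne h.ne)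
    (D.dir_ne_zero h) fun hz =>
      disjoint_left.1 (D.disjoint h h' hne) hz (D.curve_mem_openArc h' ht)

theorem continuousOn_viewArg {v w x y : V} (h : G.Adj v w) (h' : G.Adj x y)
    (hne : s(v, w) ≠ s(x, y)) :
    ContinuousOn (fun t => D.viewArg v w (D.curve x y t)) (Ioo 0 1) := by
  intro t ht
  have hc := ((D.continuousOn_curve h').mono Ioo_subset_Icc_self) t ht
  have hmem := D.arcRatio_curve_mem_slitPlane h h' hne ht
  refine (Complex.continuousAt_arg hmem).comp_continuousWithinAt (f := fun t =>
    arcRatio (D.pos v) (D.pos w) (D.dir v w) (D.curve x y t)) ?_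
  unfold arcRatio
  refine ContinuousWithinAt.div (by fun_prop) (by fun_prop) ?_
  exact mul_ne_zero (sub_ne_zero.2 (D.curve_ne_pos h' ht v).symm)
    (sub_ne_zero.2 (D.pos_ne h.ne').symm.symm)

open Classical in
/-- The limit of `viewArg v w` at `x` along the edge from `x` to `y`. -/
noncomputable def limArg (v w x y : V) : ℝ :=
  if x = w then Real.pi / 2 * (((D.rot w y - D.rot w v).val : ℝ) - 2)
  else if x = v then Real.pi / 2 * (((D.rot v w - D.rot v y).val : ℝ) - 2)
  else D.viewArg v w (D.pos x)

theorem tendsto_curve {x y : V} (h : G.Adj x y) :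
    Tendsto (D.curve x y) (𝓝[>] 0) (𝓝 (D.pos x)) := by
  have h1 := D.continuousOn_curve h 0 (by simp)
  rw [ContinuousWithinAt, D.curve_zero h] at h1
  exact h1.mono_left (by
    rw [← nhdsWithin_Ioo_eq_nhdsGT (zero_lt_one' ℝ)]
    exact nhdsWithin_mono _ Ioo_subset_Icc_self)

theorem tendsto_curve_sub_div {x y : V} (h : G.Adj x y) :
    ∃ s : ℝ, 0 < s ∧ Tendsto (fun t : ℝ => (t : ℂ)⁻¹ * (D.curve x y t - D.pos x)) (𝓝[>] 0)
      (𝓝 (s * D.dir x y)) := by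
  obtain ⟨s, hs, hd⟩ := D.hasDerivWithinAt_curve h
  refine ⟨s, hs, ?_⟩
  have h1 := hasDerivWithinAt_iff_tendsto_slope.1 hd
  have h2 : 𝓝[>] (0 : ℝ) ≤ 𝓝[Icc 0 1 \ {0}] 0 := by
    rw [← nhdsWithin_Ioo_eq_nhdsGT (zero_lt_one' ℝ)]
    exact nhdsWithin_mono _ fun t ht => ⟨⟨ht.1.le, ht.2.le⟩, ht.1.ne'⟩
  refine (h1.mono_left h2).congr fun t => ?_
  simp [slope_def_module, D.curve_zero h]

theorem tendsto_viewArg {v w x y : V} (h : G.Adj v w) (h' : G.Adj x y)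
    (hne : s(v, w) ≠ s(x, y)) :
    Tendsto (fun t => D.viewArg v w (D.curve x y t)) (𝓝[>] 0) (𝓝 (D.limArg v w x y)) := by
  have hc := D.tendsto_curve h'
  have hvw : D.pos w - D.pos v ≠ 0 := sub_ne_zero.2 (D.pos_ne h.ne')
  have hev : ∀ᶠ t : ℝ in 𝓝[>] 0, 0 < t := self_mem_nhdsWithin
  obtain ⟨s, hs, hslope⟩ := D.tendsto_curve_sub_div h'
  have hsC : (s : ℂ) ≠ 0 := by exact_mod_cast hs.ne'
  unfold limArg
  split_ifs with h1 h2
  · subst h1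
    have hyv : y ≠ v := by rintro rfl; exact hne Sym2.eq_swap
    obtain ⟨hslit, harg⟩ := neg_I_pow_mem_slitPlane (D.rot_sub_ne_zero h' h.symm hyv)
    obtain ⟨r, hr, hdir⟩ := D.dir_mul_dir h
    rw [← harg]
    have hlim : Tendsto (fun t : ℝ => -((t : ℂ)⁻¹ * (D.curve x y t - D.pos x)) * D.dir v x /
        ((D.pos v - D.curve x y t) * (D.pos x - D.pos v))) (𝓝[>] 0)
        (𝓝 (-(s * D.dir x y) * D.dir v x / ((D.pos v - D.pos x) * (D.pos x - D.pos v)))) := by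
      refine (hslope.neg.mul_const _).div ((hc.const_sub _).mul_const _) ?_
      exact mul_ne_zero (sub_ne_zero.2 (D.pos_ne h.ne)) hvw
    have heq : -(s * D.dir x y) * D.dir v x / ((D.pos v - D.pos x) * (D.pos x - D.pos v)) =
        ((s * r : ℝ) : ℂ) * -Complex.I ^ (D.rot x y - D.rot x v).val := by
      rw [D.dir_eq_mul h' h.symm, div_eq_iff
        (mul_ne_zero (sub_ne_zero.2 (D.pos_ne h.ne)) hvw)]
      push_cast
      linear_combination (-s * Complex.I ^ (D.rot x y - D.rot x v).val) * hdir
    rw [heq] at hlim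
    have hpos : 0 < s * r := by positivity
    have hmem : ((s * r : ℝ) : ℂ) * -Complex.I ^ (D.rot x y - D.rot x v).val ∈
        Complex.slitPlane := by
      rw [Complex.mem_slitPlane_iff] at hslit ⊢
      rw [Complex.re_ofReal_mul, Complex.im_ofReal_mul]
      exact hslit.imp (mul_pos hpos) (mul_ne_zero hpos.ne')
    have h3 := (Complex.continuousAt_arg hmem).tendsto.comp hlim
    rw [Complex.arg_real_mul _ hpos] at h3
    refine h3.congr' ?_
    filter_upwards [hev] with t ht
    have : -((t : ℂ)⁻¹ * (D.curve x y t - D.pos x)) * D.dir v x /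
        ((D.pos v - D.curve x y t) * (D.pos x - D.pos v)) =
        ((t⁻¹ : ℝ) : ℂ) * arcRatio (D.pos v) (D.pos x) (D.dir v x) (D.curve x y t) := by
      rw [arcRatio]; push_cast; ring
    rw [Function.comp_apply, this, Complex.arg_real_mul _ (inv_pos.2 ht), viewArg]
  · subst h2
    have hyw : w ≠ y := by rintro rfl; exact hne rfl
    obtain ⟨hslit, harg⟩ := neg_I_pow_mem_slitPlane (D.rot_sub_ne_zero h h' hyw)
    rw [← harg]
    have hdir0 := D.dir_ne_zero h'
    have hlim : Tendsto (fun t : ℝ => (D.pos w - D.curve x y t) * D.dir x w /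
        (-((t : ℂ)⁻¹ * (D.curve x y t - D.pos x)) * (D.pos w - D.pos x))) (𝓝[>] 0)
        (𝓝 ((D.pos w - D.pos x) * D.dir x w / (-(s * D.dir x y) * (D.pos w - D.pos x)))) := by
      refine ((hc.const_sub _).mul_const _).div (hslope.neg.mul_const _) ?_
      exact mul_ne_zero (neg_ne_zero.2 (mul_ne_zero hsC hdir0)) hvw
    have heq : (D.pos w - D.pos x) * D.dir x w / (-(s * D.dir x y) * (D.pos w - D.pos x)) =
        ((s⁻¹ : ℝ) : ℂ) * -Complex.I ^ (D.rot x w - D.rot x y).val := by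
      rw [D.dir_eq_mul h h']
      push_cast
      field_simp
    rw [heq] at hlim
    have hpos : 0 < s⁻¹ := by positivity
    have hmem : ((s⁻¹ : ℝ) : ℂ) * -Complex.I ^ (D.rot x w - D.rot x y).val ∈
        Complex.slitPlane := by
      rw [Complex.mem_slitPlane_iff] at hslit ⊢
      rw [Complex.re_ofReal_mul, Complex.im_ofReal_mul]
      exact hslit.imp (mul_pos hpos) (mul_ne_zero hpos.ne')
    have h3 := (Complex.continuousAt_arg hmem).tendsto.comp hlim
    rw [Complex.arg_real_mul _ hpos] at h3
    refine h3.congr' ?_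
    filter_upwards [hev] with t ht
    have htC : (t : ℂ) ≠ 0 := by exact_mod_cast ht.ne'
    have : (D.pos w - D.curve x y t) * D.dir x w /
        (-((t : ℂ)⁻¹ * (D.curve x y t - D.pos x)) * (D.pos w - D.pos x)) =
        (t : ℂ) * arcRatio (D.pos x) (D.pos w) (D.dir x w) (D.curve x y t) := by
      rw [arcRatio, ← mul_div_assoc, show -((t : ℂ)⁻¹ * (D.curve x y t - D.pos x)) *
        (D.pos w - D.pos x) = (t : ℂ)⁻¹ * ((D.pos x - D.curve x y t) * (D.pos w - D.pos x)) by ring,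
        div_mul_eq_div_div, div_inv_eq_mul]
      ring
    rw [Function.comp_apply, this, Complex.arg_real_mul _ ht, viewArg]
  · have hmem := arcRatio_mem_slitPlane (D.pos_ne h2) (D.pos_ne h1) (D.pos_ne h.ne)
      (D.dir_ne_zero h) (D.pos_notMem h x)
    refine (Complex.continuousAt_arg hmem).tendsto.comp ?_
    unfold arcRatio
    refine ((hc.const_sub _).mul_const _).div ((hc.const_sub _).mul_const _) ?_
    exact mul_ne_zero (sub_ne_zero.2 (D.pos_ne (Ne.symm h2))) hvw

/-- Along an edge, the sum of the angles under which other edges are seen does not change, as soon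
as it is constant modulo `2π`. -/
theorem sum_limArg_symm {ι : Type*} (s : Finset ι) (v w : ι → V) {x y : V} (h' : G.Adj x y)
    (h : ∀ i ∈ s, G.Adj (v i) (w i)) (hne : ∀ i ∈ s, s(v i, w i) ≠ s(x, y)) (C : ℂ)
    (hC : ∀ z ∈ openArc (D.pos x) (D.pos y) (D.dir x y), (∀ i, z ≠ D.pos i) → ∃ r : ℝ, 0 < r ∧
      ∏ i ∈ s, (D.pos (w i) - z) / (D.pos (v i) - z) = r * C) :
    ∑ i ∈ s, D.limArg (v i) (w i) x y = ∑ i ∈ s, D.limArg (v i) (w i) y x := by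
  set f : ℝ → ℝ := fun t => ∑ i ∈ s, D.viewArg (v i) (w i) (D.curve x y t) with hf
  have hcont : ContinuousOn f (Ioo 0 1) :=
    continuousOn_finsetSum _ fun i hi => D.continuousOn_viewArg (h i hi) h' (hne i hi)
  set K : ℂ := C * ∏ i ∈ s, D.dir (v i) (w i) / (D.pos (w i) - D.pos (v i)) with hK
  have hexp : ∀ t ∈ Ioo (0 : ℝ) 1, Complex.exp (f t * Complex.I) = K / ‖K‖ := by
    intro t ht
    obtain ⟨r, hr, hprod⟩ := hC _ (D.curve_mem_openArc h' ht) (D.curve_ne_pos h' ht)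
    have h1 : ∏ i ∈ s, arcRatio (D.pos (v i)) (D.pos (w i)) (D.dir (v i) (w i)) (D.curve x y t) =
        r * K := by
      rw [hK, ← mul_assoc, ← hprod, ← Finset.prod_mul_distrib]
      refine Finset.prod_congr rfl fun i _ => ?_
      rw [arcRatio, div_mul_div_comm]
    have h2 := exp_sum_arg_mul_I s (fun i =>
      arcRatio (D.pos (v i)) (D.pos (w i)) (D.dir (v i) (w i)) (D.curve x y t)) fun i hi =>
        Complex.slitPlane_ne_zero (D.arcRatio_curve_mem_slitPlane (h i hi) h' (hne i hi) ht)
    have hrC : (r : ℂ) ≠ 0 := by exact_mod_cast hr.ne'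
    rw [h1] at h2
    refine h2.trans ?_
    rw [norm_mul, Complex.norm_real, Real.norm_of_nonneg hr.le, Complex.ofReal_mul,
      mul_div_mul_left _ _ hrC]
  have hconst := eq_of_exp_mul_I_eq hcont hexp
  have hhalf : (1 / 2 : ℝ) ∈ Ioo (0 : ℝ) 1 := by norm_num
  have hev : ∀ᶠ t : ℝ in 𝓝[>] 0, t ∈ Ioo (0 : ℝ) 1 := Ioo_mem_nhdsGT zero_lt_one
  have l1 : Tendsto f (𝓝[>] 0) (𝓝 (∑ i ∈ s, D.limArg (v i) (w i) x y)) :=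
    tendsto_finsetSum _ fun i hi => D.tendsto_viewArg (h i hi) h' (hne i hi)
  have l2 : Tendsto (fun t => ∑ i ∈ s, D.viewArg (v i) (w i) (D.curve y x t)) (𝓝[>] 0)
      (𝓝 (∑ i ∈ s, D.limArg (v i) (w i) y x)) :=
    tendsto_finsetSum _ fun i hi => D.tendsto_viewArg (h i hi) h'.symm
      (by rw [Sym2.eq_swap (a := y)]; exact hne i hi)
  have e1 : ∑ i ∈ s, D.limArg (v i) (w i) x y = f (1 / 2) := by
    refine tendsto_nhds_unique l1 (tendsto_const_nhds.congr' ?_)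
    filter_upwards [hev] with t ht using hconst _ hhalf _ ht
  have e2 : ∑ i ∈ s, D.limArg (v i) (w i) y x = f (1 / 2) := by
    refine tendsto_nhds_unique l2 (tendsto_const_nhds.congr' ?_)
    filter_upwards [hev] with t ht
    have ht' : 1 - t ∈ Ioo (0 : ℝ) 1 := ⟨by linarith [ht.2], by linarith [ht.1]⟩
    rw [hconst _ hhalf _ ht', hf]
    simp only [D.curve_symm h' t ⟨ht.1.le, ht.2.le⟩]
  rw [e1, e2]

end RightAngleDrawing

theorem Fin.add_one_ne_self (n : ℕ) (i : Fin (n + 3)) : i + 1 ≠ i := by simp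

theorem Fin.add_one_add_one_ne_self (n : ℕ) (i : Fin (n + 3)) : i + 1 + 1 ≠ i := by
  rw [add_assoc, Ne, add_eq_left, Fin.ext_iff]
  simp [Fin.val_add, Nat.mod_eq_of_lt]

theorem Fin.eq_of_add_one_eq {n : ℕ} {α : Type*} {K : Fin (n + 3) → α}
    (h : ∀ i, K (i + 1) = K i) (i : Fin (n + 3)) : K i = K 0 := by
  induction i using Fin.induction with
  | zero => rfl
  | succ i ih => rw [← Fin.coeSucc_eq_succ, h, ih]

theorem ZMod.val_add_val_sub_eq_iff : ∀ a b : ZMod 4, a ≠ 0 → b ≠ 0 → b ≠ a →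
    (a.val + (b - a).val = b.val ↔ a.val < b.val) := by decide

namespace RightAngleDrawing

variable {V : Type*} {G : SimpleGraph V} (D : RightAngleDrawing G)

theorem limArg_head {v w y : V} : D.limArg v w w y =
    Real.pi / 2 * (((D.rot w y - D.rot w v).val : ℝ) - 2) := by simp [limArg]

theorem limArg_tail {v w y : V} (h : v ≠ w) : D.limArg v w v y =
    Real.pi / 2 * (((D.rot v w - D.rot v y).val : ℝ) - 2) := by simp [limArg, h]

theorem limArg_of_ne {v w x y : V} (hw : x ≠ w) (hv : x ≠ v) : D.limArg v w x y =
    D.viewArg v w (D.pos x) := by simp [limArg, hw, hv]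

/-- Every cycle of the drawing has two sides. The predicate `S x y` says that the edge from `x` to
`y` starts on the side which, at every vertex of the cycle, is swept by turning counterclockwise from
the previous edge of the cycle to the next one. -/
theorem exists_side {n : ℕ} (v : Fin (n + 3) → V) (hv : Function.Injective v)
    (hadj : ∀ i, G.Adj (v i) (v (i + 1))) :
    ∃ S : V → V → Prop,
      (∀ x y, G.Adj x y → y ∉ range v → (S x y ↔ S y x)) ∧
      (∀ x y y', x ∉ range v → (S x y ↔ S x y')) ∧
      (∀ i y, G.Adj (v (i + 1)) y → y ≠ v i → y ≠ v (i + 1 + 1) →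
        (S (v (i + 1)) y ↔ (D.rot (v (i + 1)) y - D.rot (v (i + 1)) (v i)).val <
          (D.rot (v (i + 1)) (v (i + 1 + 1)) - D.rot (v (i + 1)) (v i)).val)) := by
  classical
  have hne1 := Fin.add_one_ne_self n
  have hne2 := Fin.add_one_add_one_ne_self n
  -- the contribution of the edges that do not end at the vertex `j + 1`
  set c : Fin (n + 3) → ℝ := fun j => ∑ i ∈ (Finset.univ.erase (j + 1)).erase j,
    D.viewArg (v i) (v (i + 1)) (D.pos (v (j + 1))) with hc
  have hrest : ∀ j y, ∑ i ∈ (Finset.univ.erase (j + 1)).erase j,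
      D.limArg (v i) (v (i + 1)) (v (j + 1)) y = c j := by
    intro j y
    refine Finset.sum_congr rfl fun i hi => ?_
    simp only [Finset.mem_erase, Finset.mem_univ, and_true] at hi
    exact D.limArg_of_ne (fun h => hi.1 (add_right_cancel (hv h)).symm) (fun h => hi.2 (hv h).symm)
  have hfull : ∀ j y, ∑ i, D.limArg (v i) (v (i + 1)) (v (j + 1)) y = c j +
      Real.pi / 2 * (((D.rot (v (j + 1)) y - D.rot (v (j + 1)) (v j)).val : ℝ) - 2) +
      Real.pi / 2 * (((D.rot (v (j + 1)) (v (j + 1 + 1)) - D.rot (v (j + 1)) y).val : ℝ) - 2) := by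
    intro j y
    rw [← Finset.add_sum_erase _ _ (Finset.mem_univ (j + 1)),
      ← Finset.add_sum_erase (Finset.univ.erase (j + 1)) _ (a := j) (by simp [(hne1 j).symm]), hrest,
      D.limArg_head, D.limArg_tail (hadj (j + 1)).ne]
    ring
  have hedge : ∀ i j, i ≠ j → s(v i, v (i + 1)) ≠ s(v j, v (j + 1)) := by
    intro i j hij h
    rw [Sym2.eq_iff] at h
    rcases h with ⟨h, -⟩ | ⟨h, h'⟩
    · exact hij (hv h)
    · have h1 := hv h
      have h2 := hv h'
      rw [h1] at h2
      exact hne2 j h2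
  have hprod : ∀ z, (∀ x, z ≠ D.pos x) →
      ∏ i, (D.pos (v (i + 1)) - z) / (D.pos (v i) - z) = 1 := by
    intro z hz
    have hshift := Equiv.prod_comp (Equiv.addRight (1 : Fin (n + 3))) fun i => D.pos (v i) - z
    simp only [Equiv.coe_addRight] at hshift
    rw [Finset.prod_div_distrib, hshift]
    exact div_self (Finset.prod_ne_zero_iff.2 fun i _ => sub_ne_zero.2 (hz _).symm)
  set K : Fin (n + 3) → ℝ := fun j => c j + Real.pi / 2 *
    (((D.rot (v (j + 1)) (v (j + 1 + 1)) - D.rot (v (j + 1)) (v j)).val : ℝ) - 2) with hK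
  have hKstep : ∀ j, K (j + 1) = K j := by
    intro j
    have hnez : D.dir (v (j + 1)) (v (j + 1 + 1)) ≠ 0 := D.dir_ne_zero (hadj _)
    have h := D.sum_limArg_symm (Finset.univ.erase (j + 1)) v (fun i => v (i + 1)) (hadj (j + 1))
      (fun i _ => hadj i) (fun i hi => hedge i (j + 1) (Finset.ne_of_mem_erase hi))
      (-(D.dir (v (j + 1)) (v (j + 1 + 1)) / (D.pos (v (j + 1 + 1)) - D.pos (v (j + 1))))) ?_
    · rw [← Finset.add_sum_erase (Finset.univ.erase (j + 1)) _ (a := j)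
        (by simp [(hne1 j).symm]), hrest, D.limArg_head,
        ← Finset.add_sum_erase (Finset.univ.erase (j + 1)) _ (a := j + 1 + 1)
        (by simp [hne1]), Finset.erase_right_comm, hrest, D.limArg_tail (hadj _).ne] at h
      simp only [hK]
      linarith
    · rintro z ⟨r, hr, hz⟩ hzne
      refine ⟨r⁻¹, by positivity, ?_⟩
      have h1 := hprod z hzne
      rw [← Finset.mul_prod_erase _ _ (Finset.mem_univ (j + 1))] at h1
      have hrC : (r : ℂ) ≠ 0 := by exact_mod_cast hr.ne'
      have n1 : D.pos (v (j + 1)) - z ≠ 0 := sub_ne_zero.2 (hzne _).symm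
      have n2 : D.pos (v (j + 1 + 1)) - z ≠ 0 := sub_ne_zero.2 (hzne _).symm
      have n3 : D.pos (v (j + 1 + 1)) - D.pos (v (j + 1)) ≠ 0 :=
        sub_ne_zero.2 (D.pos_ne (hadj _).ne')
      refine (eq_inv_of_mul_eq_one_right h1).trans ?_
      push_cast
      rw [inv_div, div_eq_iff n2]
      field_simp
      linear_combination hz
  refine ⟨fun x y => ∑ i, D.limArg (v i) (v (i + 1)) x y = K 0 - Real.pi, ?_, ?_, ?_⟩
  · intro x y hxy hy
    have hoff : ∀ i, s(v i, v (i + 1)) ≠ s(x, y) := by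
      intro i h
      rcases Sym2.eq_iff.1 h with ⟨-, h⟩ | ⟨h, -⟩
      · exact hy ⟨_, h⟩
      · exact hy ⟨_, h⟩
    beta_reduce
    rw [D.sum_limArg_symm Finset.univ v (fun i => v (i + 1)) hxy (fun i _ => hadj i)
      (fun i _ => hoff i) 1 fun z _ hz => ⟨1, one_pos, by simpa using hprod z hz⟩]
  · intro x y y' hx
    have : ∀ y, ∑ i, D.limArg (v i) (v (i + 1)) x y =
        ∑ i, D.viewArg (v i) (v (i + 1)) (D.pos x) := fun y =>
      Finset.sum_congr rfl fun i _ => D.limArg_of_ne (fun h => hx ⟨_, h.symm⟩)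
        (fun h => hx ⟨_, h.symm⟩)
    beta_reduce
    rw [this, this]
  · intro i y hy hyi hyi'
    have n1 := D.rot_sub_ne_zero hy (hadj i).symm hyi
    have n2 := D.rot_sub_ne_zero (hadj (i + 1)) (hadj i).symm
      (fun h => hne2 i (hv h))
    have n3 : D.rot (v (i + 1)) (v (i + 1 + 1)) - D.rot (v (i + 1)) (v i) ≠
        D.rot (v (i + 1)) y - D.rot (v (i + 1)) (v i) := fun h =>
      hyi' (D.rot_inj (hadj (i + 1)) hy (sub_left_injective h)).symm
    beta_reduce
    rw [← ZMod.val_add_val_sub_eq_iff _ _ n1 n2 n3, sub_sub_sub_cancel_right, hfull,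
      ← Fin.eq_of_add_one_eq hKstep i]
    simp only [hK]
    rw [← Nat.cast_inj (R := ℝ), Nat.cast_add]
    have hpi := Real.pi_pos.ne'
    constructor
    · intro h
      apply mul_left_cancel₀ hpi
      linear_combination 2 * h
    · intro h
      rw [← h]; ring

end RightAngleDrawing

/-- Two vertices `a`, `f`, each joined to `p`, `r`, `q`, `s`, where `p` and `r` are joined by an edge
and by a path of length four, and so are `q` and `s`. -/
structure DoubledPattern {V : Type*} (G : SimpleGraph V)
    (a f p r q s x₁ x₂ x₃ y₁ y₂ y₃ : V) : Prop where
  nodup : [a, f, p, r, q, s, x₁, x₂, x₃, y₁, y₂, y₃].Nodup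
  ap : G.Adj a p
  ar : G.Adj a r
  aq : G.Adj a q
  as : G.Adj a s
  fp : G.Adj f p
  fr : G.Adj f r
  fq : G.Adj f q
  fs : G.Adj f s
  rp : G.Adj r p
  rx : G.Adj r x₁
  xx : G.Adj x₁ x₂
  xx' : G.Adj x₂ x₃
  xp : G.Adj x₃ p
  sq : G.Adj s q
  sy : G.Adj s y₁
  yy : G.Adj y₁ y₂
  yy' : G.Adj y₂ y₃
  yq : G.Adj y₃ q

namespace DoubledPattern

variable {V : Type*} {G : SimpleGraph V} {a f p r q s x₁ x₂ x₃ y₁ y₂ y₃ : V}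

theorem swap_pairs (h : DoubledPattern G a f p r q s x₁ x₂ x₃ y₁ y₂ y₃) :
    DoubledPattern G a f q s p r y₁ y₂ y₃ x₁ x₂ x₃ where
  nodup := by
    have := h.nodup
    simp only [List.nodup_cons, List.mem_cons, List.not_mem_nil, or_false, not_or] at this ⊢
    grind
  ap := h.aq
  ar := h.as
  aq := h.ap
  as := h.ar
  fp := h.fq
  fr := h.fs
  fq := h.fp
  fs := h.fr
  rp := h.sq
  rx := h.sy
  xx := h.yy
  xx' := h.yy'
  xp := h.yq
  sq := h.rp
  sy := h.rx
  yy := h.xx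
  yy' := h.xx'
  yq := h.xp

theorem flip_first (h : DoubledPattern G a f p r q s x₁ x₂ x₃ y₁ y₂ y₃) :
    DoubledPattern G a f r p q s x₃ x₂ x₁ y₁ y₂ y₃ where
  nodup := by
    have := h.nodup
    simp only [List.nodup_cons, List.mem_cons, List.not_mem_nil, or_false, not_or] at this ⊢
    grind
  ap := h.ar
  ar := h.ap
  aq := h.aq
  as := h.as
  fp := h.fr
  fr := h.fp
  fq := h.fq
  fs := h.fs
  rp := h.rp.symm
  rx := h.xp.symm
  xx := h.xx'.symm
  xx' := h.xx.symm
  xp := h.rx.symm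
  sq := h.sq
  sy := h.sy
  yy := h.yy
  yy' := h.yy'
  yq := h.yq

theorem flip_second (h : DoubledPattern G a f p r q s x₁ x₂ x₃ y₁ y₂ y₃) :
    DoubledPattern G a f p r s q x₁ x₂ x₃ y₃ y₂ y₁ :=
  h.swap_pairs.flip_first.swap_pairs

end DoubledPattern

theorem ZMod.eq_neg_one_of_val_lt : ∀ A B T : ZMod 4, A ≠ B → A ≠ 0 → B ≠ 0 →
    A.val < T.val → B.val < T.val → T = -1 := by decide

theorem ZMod.val_lt_val_neg_one : ∀ A : ZMod 4, A ≠ -1 → A.val < (-1 : ZMod 4).val := by decide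

theorem ZMod.not_val_lt_two_iff : ∀ A B : ZMod 4, A ≠ B → A ≠ 0 → B ≠ 0 → A ≠ 2 → B ≠ 2 →
    ¬ (A.val < (2 : ZMod 4).val ↔ B.val < (2 : ZMod 4).val) := by decide

theorem ZMod.add_eq_zero_of_val_lt_iff : ∀ A B C E : ZMod 4, A ≠ 0 → A ≠ 1 → B ≠ 0 → B ≠ 1 →
    A ≠ B → C ≠ 0 → C ≠ -1 → E ≠ 0 → E ≠ -1 → C ≠ E →
    (B.val < A.val ↔ (E - C).val < (-C).val) → A + C = 0 := by decide

namespace RightAngleDrawing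

variable {V : Type*} {G : SimpleGraph V} (D : RightAngleDrawing G)
  {a f p r q s x₁ x₂ x₃ y₁ y₂ y₃ : V}

/-- If `p` comes right before `q` around `a`, then the cycle `a p f q` is a face. -/
theorem rot_quadrilateral (h : DoubledPattern G a f p r q s x₁ x₂ x₃ y₁ y₂ y₃)
    (hpq : D.rot a p - D.rot a q = -1) :
    D.rot p f - D.rot p a = -1 ∧ D.rot f q - D.rot f p = -1 ∧ D.rot q a - D.rot q f = -1 := by
  have hnd := h.nodup
  simp only [List.nodup_cons, List.mem_cons, List.not_mem_nil, or_false, not_or] at hnd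
  set v : Fin (1 + 3) → V := ![a, p, f, q] with hvdef
  have hrange : ∀ x, x ∉ range v ↔ x ≠ a ∧ x ≠ p ∧ x ≠ f ∧ x ≠ q := by
    intro x
    simp only [hvdef, Matrix.range_cons, Matrix.range_empty, union_empty, mem_union,
      mem_singleton_iff, not_or, ne_eq]
  have hinj : Function.Injective v := by
    intro i j hij
    fin_cases i <;> fin_cases j <;> simp [hvdef] at hij ⊢ <;> grind
  have hadj : ∀ i, G.Adj (v i) (v (i + 1)) := by
    intro i
    fin_cases i
    exacts [h.ap, h.fp.symm, h.fq, h.aq.symm]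
  obtain ⟨S, hsymm, hoff, hon⟩ := D.exists_side v hinj hadj
  have hr : r ∉ range v := (hrange r).2 (by grind)
  have hs : s ∉ range v := (hrange s).2 (by grind)
  have hx₁ : x₁ ∉ range v := (hrange _).2 (by grind)
  have hx₂ : x₂ ∉ range v := (hrange _).2 (by grind)
  have hx₃ : x₃ ∉ range v := (hrange _).2 (by grind)
  have hy₁ : y₁ ∉ range v := (hrange _).2 (by grind)
  have hy₂ : y₂ ∉ range v := (hrange _).2 (by grind)
  have hy₃ : y₃ ∉ range v := (hrange _).2 (by grind)
  have hona : ∀ y, G.Adj a y → y ≠ q → y ≠ p →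
      (S a y ↔ (D.rot a y - D.rot a q).val < (D.rot a p - D.rot a q).val) := hon 3
  have honp : ∀ y, G.Adj p y → y ≠ a → y ≠ f →
      (S p y ↔ (D.rot p y - D.rot p a).val < (D.rot p f - D.rot p a).val) := hon 0
  have honf : ∀ y, G.Adj f y → y ≠ p → y ≠ q →
      (S f y ↔ (D.rot f y - D.rot f p).val < (D.rot f q - D.rot f p).val) := hon 1
  have honq : ∀ y, G.Adj q y → y ≠ f → y ≠ a →
      (S q y ↔ (D.rot q y - D.rot q f).val < (D.rot q a - D.rot q f).val) := hon 2
  have sub_ne : ∀ {u w w' w'' : V}, G.Adj u w → G.Adj u w' → w ≠ w' →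
      D.rot u w - D.rot u w'' ≠ D.rot u w' - D.rot u w'' := fun hw hw' hne he =>
    hne (D.rot_inj hw hw' (sub_left_injective he))
  have hSa : ∀ y, G.Adj a y → y ≠ q → y ≠ p → S a y := by
    intro y hy hyq hyp
    rw [hona y hy hyq hyp, hpq]
    exact ZMod.val_lt_val_neg_one _ (hpq ▸ sub_ne hy h.ap hyp)
  have hSr : ∀ y, S r y := fun y =>
    (hoff r a y hr).1 ((hsymm a r h.ar hr).1 (hSa r h.ar (by grind) (by grind)))
  have hSs : ∀ y, S s y := fun y =>
    (hoff s a y hs).1 ((hsymm a s h.as hs).1 (hSa s h.as (by grind) (by grind)))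
  have hSpr : S p r := (hsymm p r h.rp.symm hr).2 (hSr p)
  have hSfr : S f r := (hsymm f r h.fr hr).2 (hSr f)
  have hSqs : S q s := (hsymm q s h.sq.symm hs).2 (hSs q)
  have hSfs : S f s := (hsymm f s h.fs hs).2 (hSs f)
  have hSpx : S p x₃ := by
    rw [hsymm p x₃ h.xp.symm hx₃, hoff x₃ p x₂ hx₃, hsymm x₃ x₂ h.xx'.symm hx₂, hoff x₂ x₃ x₁ hx₂,
      hsymm x₂ x₁ h.xx.symm hx₁, hoff x₁ x₂ r hx₁, hsymm x₁ r h.rx.symm hr]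
    exact hSr _
  have hSqy : S q y₃ := by
    rw [hsymm q y₃ h.yq.symm hy₃, hoff y₃ q y₂ hy₃, hsymm y₃ y₂ h.yy'.symm hy₂, hoff y₂ y₃ y₁ hy₂,
      hsymm y₂ y₁ h.yy.symm hy₁, hoff y₁ y₂ s hy₁, hsymm y₁ s h.sy.symm hs]
    exact hSs _
  refine ⟨?_, ?_, ?_⟩
  · exact ZMod.eq_neg_one_of_val_lt _ _ _ (sub_ne h.rp.symm h.xp.symm (by grind))
      (D.rot_sub_ne_zero h.rp.symm h.ap.symm (by grind))
      (D.rot_sub_ne_zero h.xp.symm h.ap.symm (by grind))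
      ((honp r h.rp.symm (by grind) (by grind)).1 hSpr)
      ((honp x₃ h.xp.symm (by grind) (by grind)).1 hSpx)
  · exact ZMod.eq_neg_one_of_val_lt _ _ _ (sub_ne h.fr h.fs (by grind))
      (D.rot_sub_ne_zero h.fr h.fp (by grind))
      (D.rot_sub_ne_zero h.fs h.fp (by grind))
      ((honf r h.fr (by grind) (by grind)).1 hSfr)
      ((honf s h.fs (by grind) (by grind)).1 hSfs)
  · exact ZMod.eq_neg_one_of_val_lt _ _ _ (sub_ne h.sq.symm h.yq.symm (by grind))
      (D.rot_sub_ne_zero h.sq.symm h.fq.symm (by grind))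
      (D.rot_sub_ne_zero h.yq.symm h.fq.symm (by grind))
      ((honq s h.sq.symm (by grind) (by grind)).1 hSqs)
      ((honq y₃ h.yq.symm (by grind) (by grind)).1 hSqy)

theorem rot_triangle (h : DoubledPattern G a f p r q s x₁ x₂ x₃ y₁ y₂ y₃) :
    (D.rot a r - D.rot a p ≠ 2) ∧
    (D.rot r f - D.rot r a = 1 → D.rot p f - D.rot p a = -1 →
      (D.rot r p - D.rot r a) + (D.rot p r - D.rot p a) = 0) := by
  have hnd := h.nodup
  simp only [List.nodup_cons, List.mem_cons, List.not_mem_nil, or_false, not_or] at hnd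
  set v : Fin (0 + 3) → V := ![a, r, p] with hvdef
  have hrange : ∀ x, x ∉ range v ↔ x ≠ a ∧ x ≠ r ∧ x ≠ p := by
    intro x
    simp only [hvdef, Matrix.range_cons, Matrix.range_empty, union_empty, mem_union,
      mem_singleton_iff, not_or, ne_eq]
  have hinj : Function.Injective v := by
    intro i j hij
    fin_cases i <;> fin_cases j <;> simp [hvdef] at hij ⊢ <;> grind
  have hadj : ∀ i, G.Adj (v i) (v (i + 1)) := by
    intro i
    fin_cases i
    exacts [h.ar, h.rp, h.ap.symm]
  obtain ⟨S, hsymm, hoff, hon⟩ := D.exists_side v hinj hadj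
  have hq : q ∉ range v := (hrange q).2 (by grind)
  have hs : s ∉ range v := (hrange s).2 (by grind)
  have hx₁ : x₁ ∉ range v := (hrange _).2 (by grind)
  have hx₂ : x₂ ∉ range v := (hrange _).2 (by grind)
  have hx₃ : x₃ ∉ range v := (hrange _).2 (by grind)
  have hona : ∀ y, G.Adj a y → y ≠ p → y ≠ r →
      (S a y ↔ (D.rot a y - D.rot a p).val < (D.rot a r - D.rot a p).val) := hon 2
  have honr : ∀ y, G.Adj r y → y ≠ a → y ≠ p →
      (S r y ↔ (D.rot r y - D.rot r a).val < (D.rot r p - D.rot r a).val) := hon 0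
  have honp : ∀ y, G.Adj p y → y ≠ r → y ≠ a →
      (S p y ↔ (D.rot p y - D.rot p r).val < (D.rot p a - D.rot p r).val) := hon 1
  have sub_ne : ∀ {u w w' w'' : V}, G.Adj u w → G.Adj u w' → w ≠ w' →
      D.rot u w - D.rot u w'' ≠ D.rot u w' - D.rot u w'' := fun hw hw' hne he =>
    hne (D.rot_inj hw hw' (sub_left_injective he))
  constructor
  · intro h2
    have hS : S a q ↔ S a s := by
      rw [hsymm a q h.aq hq, hoff q a s hq, hsymm q s h.sq.symm hs, hoff s q a hs,
        hsymm a s h.as hs]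
    rw [hona q h.aq (by grind) (by grind), hona s h.as (by grind) (by grind), h2] at hS
    exact ZMod.not_val_lt_two_iff _ _ (sub_ne h.aq h.as (by grind))
      (D.rot_sub_ne_zero h.aq h.ap (by grind)) (D.rot_sub_ne_zero h.as h.ap (by grind))
      (h2 ▸ sub_ne h.aq h.ar (by grind)) (h2 ▸ sub_ne h.as h.ar (by grind)) hS
  · intro hrf hpf
    have hS : S r x₁ ↔ S p x₃ := by
      rw [hsymm r x₁ h.rx hx₁, hoff x₁ r x₂ hx₁, hsymm x₁ x₂ h.xx hx₂, hoff x₂ x₁ x₃ hx₂,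
        hsymm x₂ x₃ h.xx' hx₃, hoff x₃ x₂ p hx₃, hsymm p x₃ h.xp.symm hx₃]
    rw [honr x₁ h.rx (by grind) (by grind), honp x₃ h.xp.symm (by grind) (by grind),
      ← sub_sub_sub_cancel_right (D.rot p x₃) (D.rot p r) (D.rot p a),
      ← neg_sub (D.rot p r) (D.rot p a)] at hS
    refine ZMod.add_eq_zero_of_val_lt_iff _ _ _ _
      (D.rot_sub_ne_zero h.rp h.ar.symm (by grind)) (hrf ▸ sub_ne h.rp h.fr.symm (by grind))
      (D.rot_sub_ne_zero h.rx h.ar.symm (by grind)) (hrf ▸ sub_ne h.rx h.fr.symm (by grind))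
      (sub_ne h.rp h.rx (by grind))
      (D.rot_sub_ne_zero h.rp.symm h.ap.symm (by grind))
      (hpf ▸ sub_ne h.rp.symm h.fp.symm (by grind))
      (D.rot_sub_ne_zero h.xp.symm h.ap.symm (by grind))
      (hpf ▸ sub_ne h.xp.symm h.fp.symm (by grind))
      (sub_ne h.rp.symm h.xp.symm (by grind)) hS

end RightAngleDrawing

theorem exists_pos_root {l c : ℝ} (hd : 8 * c ≤ l ^ 2) (h : c < 0 ∨ l < 0) :
    ∃ s : ℝ, 0 < s ∧ 2 * s ^ 2 + l * s + c = 0 := by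
  have hsq := Real.sq_sqrt (sub_nonneg.2 hd)
  have h0 := Real.sqrt_nonneg (l ^ 2 - 8 * c)
  refine ⟨(-l + √(l ^ 2 - 8 * c)) / 4, ?_, by nlinarith⟩
  rcases h with h | h
  · have : l < √(l ^ 2 - 8 * c) := Real.lt_sqrt_of_sq_lt (by linarith)
    linarith
  · linarith

/-- The order of the images of the vertices on the real line that is forced by the absence of
crossings is contradictory. -/
theorem no_real_configuration {B C D E : ℝ} (hB : B ≠ 0) (hC : C ≠ 0) (hD : D ≠ 0)
    (hE : E ≠ 0) (hBC : B ≠ C) (hBE : B ≠ E)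
    (hDC : D ≠ C) (hCE : C < E) (hDB : D < B)
    (bc : ∀ s : ℝ, 0 < s → 2 * s ^ 2 + (2 * B - C + C) * s + B * (B - C) ≠ 0)
    (be : ∀ s : ℝ, 0 < s → 2 * s ^ 2 + (2 * B - E - E) * s + B * (B - E) ≠ 0)
    (dc : ∀ s : ℝ, 0 < s → 2 * s ^ 2 + (-(2 * D - C) + C) * s + D * (D - C) ≠ 0)
    (cb : ∀ s : ℝ, 0 < s → 2 * s ^ 2 + (-(2 * C - B) - B) * s + C * (C - B) ≠ 0)
    (cd : ∀ s : ℝ, 0 < s → 2 * s ^ 2 + (-(2 * C - D) + D) * s + C * (C - D) ≠ 0)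
    (eb : ∀ s : ℝ, 0 < s → 2 * s ^ 2 + (2 * E - B - B) * s + E * (E - B) ≠ 0) : False := by
  have opp : ∀ {P Q l l' : ℝ}, P ≠ Q → P ≠ 0 → Q ≠ 0 →
      (∀ s : ℝ, 0 < s → 2 * s ^ 2 + l * s + P * (P - Q) ≠ 0) →
      (∀ s : ℝ, 0 < s → 2 * s ^ 2 + l' * s + Q * (Q - P) ≠ 0) → P * Q < 0 := by
    intro P Q l l' hPQ hP hQ h1 h2
    have k1 : 0 ≤ P * (P - Q) := by
      by_contra! hneg
      obtain ⟨s, hs, h⟩ := exists_pos_root (l := l) (by nlinarith [sq_nonneg l]) (.inl hneg)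
      exact h1 s hs h
    have k2 : 0 ≤ Q * (Q - P) := by
      by_contra! hneg
      obtain ⟨s, hs, h⟩ := exists_pos_root (l := l') (by nlinarith [sq_nonneg l']) (.inl hneg)
      exact h2 s hs h
    by_contra! hpos
    have hpos : 0 < P * Q := lt_of_le_of_ne hpos (mul_ne_zero hP hQ).symm
    rcases hPQ.lt_or_gt with hlt | hlt <;> rcases hP.lt_or_gt with hp | hp <;>
      rcases hQ.lt_or_gt with hq | hq <;> nlinarith
  have hBC' := opp hBC hB hC bc cb
  rcases hB.lt_or_gt with hB | hB
  · have hC : 0 < C := by nlinarith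
    have h1 : E < -B := by
      by_contra! hle
      obtain ⟨s, hs, h⟩ := exists_pos_root (l := 2 * B - E - E) (c := B * (B - E))
        (by nlinarith) (.inr (by linarith))
      exact be s hs h
    have h2 : -D < C := by
      by_contra! hle
      obtain ⟨s, hs, h⟩ := exists_pos_root (l := -(2 * C - D) + D) (c := C * (C - D))
        (by nlinarith) (.inr (by linarith))
      exact cd s hs h
    linarith
  · have hC : C < 0 := by nlinarith
    have hE : E < 0 := by
      have := opp hBE hB.ne' hE be eb
      nlinarith
    have hD : 0 < D := by
      have := opp hDC hD hC.ne dc cd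
      nlinarith
    have h1 : -C < D := by
      by_contra! hle
      obtain ⟨s, hs, h⟩ := exists_pos_root (l := -(2 * D - C) + C) (c := D * (D - C))
        (by nlinarith) (.inr (by linarith))
      exact dc s hs h
    have h2 : B < -E := by
      by_contra! hle
      obtain ⟨s, hs, h⟩ := exists_pos_root (l := 2 * E - B - B) (c := E * (E - B))
        (by nlinarith) (.inr (by linarith))
      exact eb s hs h
    linarith

section Moebius

variable {a f x u k Z v : ℂ} {X t : ℝ}

theorem coord_ne (haf : a ≠ f) (hk : k ≠ 0) (hX : k * (x - a) = X * (x - f)) : (X : ℂ) - k ≠ 0 := by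
  intro h
  apply haf
  rw [sub_eq_zero.1 h] at hX
  have := mul_left_cancel₀ hk hX
  linear_combination -this

theorem eq_moebius (haf : a ≠ f) (hk : k ≠ 0) (hX : k * (x - a) = X * (x - f)) :
    x = (X * f - k * a) / (X - k) := by
  rw [eq_div_iff (coord_ne haf hk hX)]
  linear_combination -hX

/-- The transformation `z ↦ k * (z - a) / (z - f)`, whose inverse is `Z ↦ (Z * f - k * a) / (Z - k)`,
on an arc that starts at `a`. -/
theorem moebius_mem_openArc_left (haf : a ≠ f) (hk : k ≠ 0) (hX : k * (x - a) = X * (x - f))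
    (ht : 0 < t) (hu : u * k = t * v * (a - f)) (hZ : Z ≠ k) {r : ℝ} (hr : 0 < r)
    (h : (X - Z) * v = r * (Z * X)) : (Z * f - k * a) / (Z - k) ∈ openArc a x u := by
  have n1 := coord_ne haf hk hX
  have n2 : Z - k ≠ 0 := sub_ne_zero.2 hZ
  refine ⟨t * r, by positivity, ?_⟩
  rw [eq_moebius haf hk hX]
  have e1 : (X * f - k * a) / (X - k) - (Z * f - k * a) / (Z - k) =
      k * (f - a) * (Z - X) / ((X - k) * (Z - k)) := by field_simp; ring
  have e2 : (Z * f - k * a) / (Z - k) - a = Z * (f - a) / (Z - k) := by field_simp; ring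
  have e3 : (X * f - k * a) / (X - k) - a = X * (f - a) / (X - k) := by field_simp; ring
  rw [e1, e2, e3, div_mul_div_comm, mul_comm (Z - k), ← mul_div_assoc, div_mul_eq_mul_div]
  congr 1
  push_cast
  linear_combination ((f - a) * (Z - X)) * hu + (t * (f - a) ^ 2) * h

/-- The same transformation on an arc that ends at `f`, which is mapped to a ray. -/
theorem moebius_mem_openArc_right (haf : a ≠ f) (hk : k ≠ 0) (hX : k * (x - a) = X * (x - f))
    (ht : 0 < t) (hu : u * (X - k) ^ 2 = t * v * k * (a - f)) (hZ : Z ≠ k) {s : ℝ} (hs : 0 < s)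
    (h : Z = X + s * v) : (Z * f - k * a) / (Z - k) ∈ openArc x f u := by
  have n1 := coord_ne haf hk hX
  have n2 : Z - k ≠ 0 := sub_ne_zero.2 hZ
  have hsC : (s : ℂ) ≠ 0 := by exact_mod_cast hs.ne'
  refine ⟨t / s, by positivity, ?_⟩
  rw [eq_moebius haf hk hX]
  have e1 : (Z * f - k * a) / (Z - k) - (X * f - k * a) / (X - k) =
      k * (f - a) * (X - Z) / ((X - k) * (Z - k)) := by field_simp; ring
  have e2 : f - (Z * f - k * a) / (Z - k) = k * (a - f) / (Z - k) := by field_simp; ring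
  have e3 : f - (X * f - k * a) / (X - k) = k * (a - f) / (X - k) := by field_simp; ring
  have hu' : u = t * v * k * (a - f) / (X - k) ^ 2 := by
    rw [eq_div_iff (pow_ne_zero 2 n1), hu]
  have h' : X - Z = -(s * v) := by rw [h]; ring
  rw [e1, e2, e3, hu', h']
  push_cast
  field_simp
  ring

theorem ray_ne_pole (haf : a ≠ f) (hk : k ≠ 0) (hX : k * (x - a) = X * (x - f))
    (ht : 0 < t) (hu : u * (X - k) ^ 2 = t * v * k * (a - f))
    (hdir : ∀ r : ℝ, 0 < r → u ≠ r * (x - f)) {s : ℝ} (hs : 0 < s) : X + s * v ≠ k := by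
  intro h
  have n1 := coord_ne haf hk hX
  have hsC : (s : ℂ) ≠ 0 := by exact_mod_cast hs.ne'
  refine hdir (t / s) (by positivity) ?_
  have h' : (X : ℂ) - k = -(s * v) := by linear_combination h
  have e3 : x - f = k * (f - a) / (X - k) := by
    rw [eq_moebius haf hk hX]; field_simp; ring
  have hu' : u = t * v * k * (a - f) / (X - k) ^ 2 := by
    rw [eq_div_iff (pow_ne_zero 2 n1), hu]
  have hv : v ≠ 0 := by
    rintro rfl
    simp at h'
    exact n1 h'
  rw [e3, hu', h']
  push_cast
  field_simp
  ring

/-- The direction in which the image of the edge from `x` to `f` leaves `X`, given the direction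
in which the image of the edge from `a` to `x` leaves the origin. -/
theorem exists_ray_direction {u' w j : ℂ} {r : ℝ} (haf : a ≠ f) (hk : k ≠ 0)
    (hX : k * (x - a) = X * (x - f)) (hX0 : X ≠ 0) (ht : 0 < t) (hu : u * k = t * v * (a - f))
    (hr : 0 < r) (huu' : u * u' = -(r * (x - a) ^ 2)) (hv : v * w = -(2 * j)) :
    ∃ t' : ℝ, 0 < t' ∧ (j * u') * (X - k) ^ 2 = t' * w * k * (a - f) := by
  have n1 := coord_ne haf hk hX
  have htC : (t : ℂ) ≠ 0 := by exact_mod_cast ht.ne'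
  have naf : a - f ≠ 0 := sub_ne_zero.2 haf
  have hXC : (X : ℂ) ≠ 0 := by exact_mod_cast hX0
  refine ⟨r * X ^ 2 / (2 * t), by positivity, ?_⟩
  have e3 : x - a = X * (f - a) / (X - k) := by
    rw [eq_moebius haf hk hX]; field_simp; ring
  have hrC : (r : ℂ) ≠ 0 := by exact_mod_cast hr.ne'
  have nu : u * k ≠ 0 := by
    intro h0
    have : u = 0 := (mul_eq_zero.1 h0).resolve_right hk
    rw [this, zero_mul, e3] at huu'
    have h1 : (r : ℂ) * (X * (f - a) / (X - k)) ^ 2 ≠ 0 :=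
      mul_ne_zero hrC (pow_ne_zero 2 (div_ne_zero (mul_ne_zero hXC (sub_ne_zero.2 haf.symm)) n1))
    exact h1 (neg_eq_zero.1 huu'.symm)
  have h2 : u * u' * (X - k) ^ 2 = -(r * (X * (f - a)) ^ 2) := by
    rw [huu', e3]; field_simp
  apply mul_left_cancel₀ nu
  push_cast
  have h3 : u * k * (r * X ^ 2 / (2 * t) * w * k * (a - f)) =
      -(j * (r * X ^ 2) * k * (a - f) ^ 2) := by
    rw [hu]
    field_simp
    linear_combination hv
  rw [h3]
  linear_combination (k * j) * h2

end Moebius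

/-- The ray from `X` in the direction `μ + ηi` meets the image of the arc to `Y` that leaves the origin
in the direction `ν + ηi`. -/
theorem exists_ray_meets_arc {X Y s μ ν η : ℝ} (hμ : μ ^ 2 = 1) (hν : ν ^ 2 = 1) (hη : η ^ 2 = 1)
    (hs : 0 < s) (h : 2 * s ^ 2 + ((2 * X - Y) * μ + Y * ν) * s + X * (X - Y) = 0) :
    ∃ r : ℝ, 0 < r ∧ (Y - (X + s * (μ + η * Complex.I))) * (ν + η * Complex.I) =
      r * ((X + s * (μ + η * Complex.I)) * Y) := by
  have hη0 : η ≠ 0 := by rintro rfl; norm_num at hη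
  set N : ℝ := (X + s * μ) ^ 2 + (s * η) ^ 2 with hN
  have hNpos : 0 < N := by positivity
  refine ⟨2 * s / N, by positivity, ?_⟩
  have hNC : (N : ℂ) ≠ 0 := by exact_mod_cast hNpos.ne'
  apply mul_right_cancel₀ hNC
  have hcancel : (((2 * s / N : ℝ)) : ℂ) * N = 2 * s := by
    push_cast; field_simp
  have hI := Complex.I_sq
  have hμC : (μ : ℂ) ^ 2 = 1 := by exact_mod_cast hμ
  have hνC : (ν : ℂ) ^ 2 = 1 := by exact_mod_cast hν
  have hηC : (η : ℂ) ^ 2 = 1 := by exact_mod_cast hη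
  have hC : (2 * s ^ 2 + ((2 * X - Y) * μ + Y * ν) * s + X * (X - Y) : ℂ) = 0 := by
    exact_mod_cast h
  have hfac : (N : ℂ) = (X + s * (μ + η * Complex.I)) * (X + s * (μ - η * Complex.I)) := by
    rw [hN]; push_cast; linear_combination (s * η) ^ 2 * hI
  have hmain : (Y - (X + s * (μ + η * Complex.I))) * (X + s * (μ - η * Complex.I)) =
      s * Y * (ν - η * Complex.I) := by
    linear_combination -hC - s ^ 2 * hμC - s ^ 2 * hηC + (s * η) ^ 2 * hI
  have hv : ((ν : ℂ) - η * Complex.I) * (ν + η * Complex.I) = 2 := by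
    linear_combination hνC + hηC - η ^ 2 * hI
  calc (Y - (X + s * (μ + η * Complex.I))) * (ν + η * Complex.I) * N
      = ((Y - (X + s * (μ + η * Complex.I))) * (X + s * (μ - η * Complex.I))) *
        (ν + η * Complex.I) * (X + s * (μ + η * Complex.I)) := by rw [hfac]; ring
    _ = s * Y * ((ν - η * Complex.I) * (ν + η * Complex.I)) *
        (X + s * (μ + η * Complex.I)) := by rw [hmain]; ring
    _ = ((2 * s / N : ℝ) : ℂ) * N * ((X + s * (μ + η * Complex.I)) * Y) := by
        rw [hv, hcancel]; ring
    _ = _ := by ring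

theorem exists_real_coord {k a f x : ℂ} {ρ : ℝ} (hρ : 0 < ρ)
    (h : (k * (x - a)) ^ 2 = ρ * (x - f) ^ 2) :
    ∃ X : ℝ, X ≠ 0 ∧ k * (x - a) = X * (x - f) := by
  have h1 : ((√ρ : ℝ) : ℂ) ^ 2 = ρ := by exact_mod_cast Real.sq_sqrt hρ.le
  have h0 : √ρ ≠ 0 := (Real.sqrt_pos.2 hρ).ne'
  rw [← h1, ← mul_pow, sq_eq_sq_iff_eq_or_eq_neg] at h
  rcases h with h | h
  · exact ⟨√ρ, h0, h⟩
  · exact ⟨-√ρ, neg_ne_zero.2 h0, by rw [h]; push_cast; ring⟩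

theorem exists_real_mul_one_add_I {w : ℂ} {m : ℝ} (hm : 0 < m) (h : w ^ 2 = m * Complex.I) :
    ∃ t : ℝ, t ≠ 0 ∧ w = t * (1 + Complex.I) := by
  have h1 : ((√(m / 2) : ℝ) : ℂ) ^ 2 = m / 2 := by
    have := Real.sq_sqrt (show 0 ≤ m / 2 by positivity)
    exact_mod_cast this
  have h0 : √(m / 2) ≠ 0 := (Real.sqrt_pos.2 (by positivity)).ne'
  have h2 : w ^ 2 = (√(m / 2) * (1 + Complex.I)) ^ 2 := by
    rw [mul_pow, h1, h]
    linear_combination (-m / 2 : ℂ) * Complex.I_sq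
  rcases sq_eq_sq_iff_eq_or_eq_neg.1 h2 with h | h
  · exact ⟨_, h0, h⟩
  · exact ⟨-√(m / 2), neg_ne_zero.2 h0, by rw [h]; push_cast; ring⟩

theorem ZMod.rot_at_second_pole : ∀ P R Q S : ZMod 4, Q - P = -1 → R - S = -1 → R ≠ P → R ≠ Q →
    S ≠ P → S ≠ Q → R - P = 1 ∧ S - P = 2 := by decide

namespace RightAngleDrawing

variable {V : Type*} {G : SimpleGraph V} (D : RightAngleDrawing G)

theorem dir_eq_I_mul {v w w' : V} (h : G.Adj v w) (h' : G.Adj v w')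
    (hr : D.rot v w - D.rot v w' = 1) : D.dir v w = Complex.I * D.dir v w' := by
  rw [D.dir_eq_mul h h', hr, show (1 : ZMod 4).val = 1 from rfl, pow_one]

theorem dir_eq_neg {v w w' : V} (h : G.Adj v w) (h' : G.Adj v w')
    (hr : D.rot v w - D.rot v w' = 2) : D.dir v w = -D.dir v w' := by
  rw [D.dir_eq_mul h h', hr, show (2 : ZMod 4).val = 2 from rfl, Complex.I_sq]
  ring

theorem dir_eq_neg_I_mul {v w w' : V} (h : G.Adj v w) (h' : G.Adj v w')
    (hr : D.rot v w - D.rot v w' = -1) : D.dir v w = -Complex.I * D.dir v w' := by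
  rw [D.dir_eq_mul h h', hr, show (-1 : ZMod 4).val = 3 from rfl, pow_succ, Complex.I_sq]
  ring

section Crossings

variable {D} {a f x y : V} {k : ℂ} {X Y : ℝ}

/-- The transformation `z ↦ k * (z - a) / (z - f)` maps the edge from `x` to `f` to the ray from `X`
in the direction `w`. -/
structure IsRay (D : RightAngleDrawing G) (a f x : V) (k : ℂ) (X : ℝ) (w : ℂ) : Prop where
  adj : G.Adj x f
  coord : k * (D.pos x - D.pos a) = X * (D.pos x - D.pos f)
  dir : ∃ t : ℝ, 0 < t ∧
    D.dir x f * (X - k) ^ 2 = t * w * k * (D.pos a - D.pos f)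

/-- The transformation `z ↦ k * (z - a) / (z - f)` maps the edge from `a` to `y` to an arc from the
origin to `Y` with initial direction `v`. -/
structure IsArc (D : RightAngleDrawing G) (a f y : V) (k : ℂ) (Y : ℝ) (v : ℂ) : Prop where
  adj : G.Adj a y
  coord : k * (D.pos y - D.pos a) = Y * (D.pos y - D.pos f)
  dir : ∃ t : ℝ, 0 < t ∧ D.dir a y * k = t * v * (D.pos a - D.pos f)

theorem IsArc.isRay {v w j : ℂ} (haf : a ≠ f) (hk : k ≠ 0) (h : D.IsArc a f x k X v)
    (hX : X ≠ 0) (hxf : G.Adj x f) (hj : D.dir x f = j * D.dir x a) (hv : v * w = -(2 * j)) :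
    D.IsRay a f x k X w := by
  obtain ⟨t, ht, hu⟩ := h.dir
  obtain ⟨r, hr, huu⟩ := D.dir_mul_dir h.adj
  refine ⟨hxf, h.coord, ?_⟩
  rw [hj]
  exact exists_ray_direction (D.pos_ne haf) hk h.coord hX ht hu hr huu hv

theorem IsRay.not_meets_ray {w w' : ℂ} {s s' : ℝ} (haf : a ≠ f) (hk : k ≠ 0) (hxy : x ≠ y)
    (h : D.IsRay a f x k X w) (h' : D.IsRay a f y k Y w') (hs : 0 < s) (hs' : 0 < s') :
    X + s * w ≠ Y + s' * w' := by
  intro he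
  obtain ⟨t, ht, hu⟩ := h.dir
  obtain ⟨t', ht', hu'⟩ := h'.dir
  have hpole := ray_ne_pole (D.pos_ne haf) hk h.coord ht hu (D.dir_ne h.adj) hs
  have m1 := moebius_mem_openArc_right (D.pos_ne haf) hk h.coord ht hu hpole hs rfl
  have m2 := moebius_mem_openArc_right (D.pos_ne haf) hk h'.coord ht' hu' hpole hs' he
  refine disjoint_left.1 (D.disjoint h.adj h'.adj ?_) m1 m2
  intro hedge
  rcases Sym2.eq_iff.1 hedge with ⟨e, -⟩ | ⟨e, -⟩
  · exact hxy e
  · exact h.adj.ne e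

theorem IsRay.not_meets_arc {μ ν η s : ℝ} (haf : a ≠ f) (hk : k ≠ 0) (hxa : x ≠ a)
    (h : D.IsRay a f x k X (μ + η * Complex.I)) (h' : D.IsArc a f y k Y (ν + η * Complex.I))
    (hμ : μ ^ 2 = 1) (hν : ν ^ 2 = 1) (hη : η ^ 2 = 1) (hs : 0 < s) :
    2 * s ^ 2 + ((2 * X - Y) * μ + Y * ν) * s + X * (X - Y) ≠ 0 := by
  intro he
  obtain ⟨r, hr, hmeet⟩ := exists_ray_meets_arc hμ hν hη hs he
  obtain ⟨t, ht, hu⟩ := h.dir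
  obtain ⟨t', ht', hu'⟩ := h'.dir
  have hpole := ray_ne_pole (D.pos_ne haf) hk h.coord ht hu (D.dir_ne h.adj) hs
  have m1 := moebius_mem_openArc_right (D.pos_ne haf) hk h.coord ht hu hpole hs rfl
  have m2 := moebius_mem_openArc_left (D.pos_ne haf) hk h'.coord ht' hu' hpole hr hmeet
  refine disjoint_left.1 (D.disjoint h.adj h'.adj ?_) m1 m2
  intro hedge
  rcases Sym2.eq_iff.1 hedge with ⟨e, -⟩ | ⟨-, e⟩
  · exact hxa e
  · exact haf e.symm

theorem coord_ne_coord (haf : a ≠ f) (hk : k ≠ 0) (hxy : x ≠ y)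
    (hX : k * (D.pos x - D.pos a) = X * (D.pos x - D.pos f))
    (hY : k * (D.pos y - D.pos a) = Y * (D.pos y - D.pos f)) : X ≠ Y := by
  rintro rfl
  exact D.pos_ne hxy ((eq_moebius (D.pos_ne haf) hk hX).trans
    (eq_moebius (D.pos_ne haf) hk hY).symm)

end Crossings

variable {a f p r q s : V}

theorem false_of_arcs {k : ℂ} {P R Q S : ℝ} (haf : a ≠ f) (hk : k ≠ 0)
    (hpr : p ≠ r) (hpq : p ≠ q) (hrq : r ≠ q) (hrs : r ≠ s) (hqs : q ≠ s)
    (hfp : G.Adj p f) (hfr : G.Adj r f) (hfq : G.Adj q f) (hfs : G.Adj s f)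
    (ar : D.IsArc a f r k R (1 + Complex.I)) (ap : D.IsArc a f p k P (-1 + Complex.I))
    (aq : D.IsArc a f q k Q (-1 - Complex.I)) (as : D.IsArc a f s k S (1 - Complex.I))
    (jr : D.dir r f = Complex.I * D.dir r a) (jp : D.dir p f = -Complex.I * D.dir p a)
    (jq : D.dir q f = Complex.I * D.dir q a) (js : D.dir s f = -Complex.I * D.dir s a)
    (hP : P ≠ 0) (hR : R ≠ 0) (hQ : Q ≠ 0) (hS : S ≠ 0) : False := by
  have hI := Complex.I_sq
  have rr : D.IsRay a f r k R (-1 - Complex.I) :=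
    ar.isRay haf hk hR hfr jr (by linear_combination -hI)
  have rp : D.IsRay a f p k P (1 - Complex.I) :=
    ap.isRay haf hk hP hfp jp (by linear_combination -hI)
  have rq : D.IsRay a f q k Q (1 + Complex.I) :=
    aq.isRay haf hk hQ hfq jq (by linear_combination -hI)
  have rs : D.IsRay a f s k S (-1 + Complex.I) :=
    as.isRay haf hk hS hfs js (by linear_combination -hI)
  have hRP : R < P := by
    refine lt_of_le_of_ne (not_lt.1 fun hlt => ?_) (coord_ne_coord haf hk hpr.symm ar.coord ap.coord)
    have h0 : 0 < (R - P) / 2 := by linarith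
    exact rr.not_meets_ray haf hk hpr.symm rp h0 h0 (by push_cast; ring)
  have hSQ : S < Q := by
    refine lt_of_le_of_ne (not_lt.1 fun hlt => ?_) (coord_ne_coord haf hk hqs.symm as.coord aq.coord)
    have h0 : 0 < (S - Q) / 2 := by linarith
    exact rq.not_meets_ray haf hk hqs rs h0 h0 (by push_cast; ring)
  have e1 : (1 + Complex.I : ℂ) = ((1 : ℝ) : ℂ) + ((1 : ℝ) : ℂ) * Complex.I := by push_cast; ring
  have e2 : (-1 + Complex.I : ℂ) = ((-1 : ℝ) : ℂ) + ((1 : ℝ) : ℂ) * Complex.I := by push_cast; ring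
  have e3 : (-1 - Complex.I : ℂ) = ((-1 : ℝ) : ℂ) + ((-1 : ℝ) : ℂ) * Complex.I := by push_cast; ring
  have e4 : (1 - Complex.I : ℂ) = ((1 : ℝ) : ℂ) + ((-1 : ℝ) : ℂ) * Complex.I := by push_cast; ring
  have o1 : (1 : ℝ) ^ 2 = 1 := by norm_num
  have o2 : (-1 : ℝ) ^ 2 = 1 := by norm_num
  rw [e1] at ar rq
  rw [e2] at ap rs
  rw [e3] at aq rr
  rw [e4] at as rp
  refine no_real_configuration hQ hR hS hP
    (coord_ne_coord haf hk hrq.symm aq.coord ar.coord)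
    (coord_ne_coord haf hk hpq.symm aq.coord ap.coord)
    (coord_ne_coord haf hk hrs.symm as.coord ar.coord) hRP hSQ ?_ ?_ ?_ ?_ ?_ ?_ <;>
    intro l hl h0
  · exact rq.not_meets_arc haf hk aq.adj.ne' ar o1 o1 o1 hl (by linarith)
  · exact rq.not_meets_arc haf hk aq.adj.ne' ap o1 o2 o1 hl (by linarith)
  · exact rs.not_meets_arc haf hk as.adj.ne' ar o2 o1 o1 hl (by linarith)
  · exact rr.not_meets_arc haf hk ar.adj.ne' aq o2 o2 o2 hl (by linarith)
  · exact rr.not_meets_arc haf hk ar.adj.ne' as o2 o1 o2 hl (by linarith)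
  · exact rp.not_meets_arc haf hk ap.adj.ne' aq o1 o2 o2 hl (by linarith)

/-- The real coordinate of `x` under a transformation that maps the circle through `a`, `f` and
their common neighbours to the real line. -/
theorem exists_coord {x : V} {k m n j A F : ℂ} (hax : G.Adj a x) (hfx : G.Adj f x)
    (hA : D.dir a x = m * A) (hF : D.dir f x = n * F) (hj : D.dir x f = j * D.dir x a)
    (hmn : j * n = -m) (hk : k ^ 2 * A = -F) :
    ∃ X : ℝ, X ≠ 0 ∧ k * (D.pos x - D.pos a) = X * (D.pos x - D.pos f) := by
  obtain ⟨r, hr, h1⟩ := D.dir_mul_dir hax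
  obtain ⟨r', hr', h2⟩ := D.dir_mul_dir hfx
  refine exists_real_coord (ρ := r' / r) (by positivity) ?_
  have hrC : (r : ℂ) ≠ 0 := by exact_mod_cast hr.ne'
  rw [hA] at h1
  rw [hF, hj] at h2
  push_cast
  rw [div_mul_eq_mul_div, eq_div_iff hrC]
  linear_combination k ^ 2 * h1 - h2 - (m * D.dir x a) * hk + (F * D.dir x a) * hmn

variable {x₁ x₂ x₃ y₁ y₂ y₃ : V}

theorem false_of_ordered (h : DoubledPattern G a f p r q s x₁ x₂ x₃ y₁ y₂ y₃)
    (hp : D.rot a p - D.rot a r = 1) (hq : D.rot a q - D.rot a r = 2)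
    (hs : D.rot a s - D.rot a r = -1) : False := by
  have hnd := h.nodup
  simp only [List.nodup_cons, List.mem_cons, List.not_mem_nil, or_false, not_or] at hnd
  have haf : a ≠ f := by grind
  have hpr : p ≠ r := by grind
  have hpq : p ≠ q := by grind
  have hps : p ≠ s := by grind
  have hrq : r ≠ q := by grind
  have hrs : r ≠ s := by grind
  have hqs : q ≠ s := by grind
  obtain ⟨hpf, hfq, hqf⟩ := D.rot_quadrilateral h
    (by rw [← sub_sub_sub_cancel_right _ _ (D.rot a r), hp, hq]; rfl)
  obtain ⟨hsf, hfr, hrf⟩ := D.rot_quadrilateral h.swap_pairs.flip_first.flip_second hs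
  have hrf' : D.rot r f - D.rot r a = 1 := by rw [← neg_sub, hrf]; rfl
  have hqf' : D.rot q f - D.rot q a = 1 := by rw [← neg_sub, hqf]; rfl
  have htri := (D.rot_triangle h).2 hrf' hpf
  have rot_ne : ∀ {v w w' : V}, G.Adj v w → G.Adj v w' → w ≠ w' → D.rot v w ≠ D.rot v w' :=
    fun hw hw' hne he => hne (D.rot_inj hw hw' he)
  obtain ⟨hfr', hfs'⟩ := ZMod.rot_at_second_pole _ _ _ _ hfq hfr (rot_ne h.fr h.fp hpr.symm)
    (rot_ne h.fr h.fq hrq) (rot_ne h.fs h.fp hps.symm) (rot_ne h.fs h.fq hqs.symm)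
  have dap := D.dir_eq_I_mul h.ap h.ar hp
  have daq := D.dir_eq_neg h.aq h.ar hq
  have das := D.dir_eq_neg_I_mul h.as h.ar hs
  have dfr := D.dir_eq_I_mul h.fr h.fp hfr'
  have dfs := D.dir_eq_neg h.fs h.fp hfs'
  have dfq := D.dir_eq_neg_I_mul h.fq h.fp hfq
  have drf := D.dir_eq_I_mul h.fr.symm h.ar.symm hrf'
  have dqf := D.dir_eq_I_mul h.fq.symm h.aq.symm hqf'
  have dpf := D.dir_eq_neg_I_mul h.fp.symm h.ap.symm hpf
  have dsf := D.dir_eq_neg_I_mul h.fs.symm h.as.symm hsf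
  have hI := Complex.I_sq
  have hA := D.dir_ne_zero h.ar
  have hF := D.dir_ne_zero h.fp
  obtain ⟨k, hk2⟩ := IsAlgClosed.exists_pow_nat_eq (-D.dir f p / D.dir a r) zero_lt_two
  have hkA : k ^ 2 * D.dir a r = -D.dir f p := by rw [hk2, div_mul_cancel₀ _ hA]
  have hk : k ≠ 0 := by
    rintro rfl
    apply hF
    linear_combination hkA
  obtain ⟨R, hR0, hR⟩ := D.exists_coord h.ar h.fr (one_mul _).symm dfr drf
    (by linear_combination hI) hkA
  obtain ⟨P, hP0, hP⟩ := D.exists_coord h.ap h.fp dap (one_mul _).symm dpf (by ring) hkA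
  obtain ⟨Q, hQ0, hQ⟩ := D.exists_coord h.aq h.fq (m := -1) (by rw [daq]; ring) dfq dqf
    (by linear_combination -hI) hkA
  obtain ⟨S, hS0, hS⟩ := D.exists_coord h.as h.fs (n := -1) das (by rw [dfs]; ring) dsf
    (by ring) hkA
  have naf : D.pos a - D.pos f ≠ 0 := sub_ne_zero.2 (D.pos_ne haf)
  obtain ⟨t, ht0, ht⟩ : ∃ t : ℝ, t ≠ 0 ∧
      D.dir a r * k / (D.pos a - D.pos f) = t * (1 + Complex.I) := by
    obtain ⟨r₁, hr₁, e₁⟩ := D.dir_mul_dir h.rp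
    obtain ⟨r₂, hr₂, e₂⟩ := D.dir_mul_dir h.ar
    obtain ⟨r₃, hr₃, e₃⟩ := D.dir_mul_dir h.ap
    have hRP : R - P ≠ 0 := sub_ne_zero.2 (coord_ne_coord haf hk hpr.symm hR hP)
    refine exists_real_mul_one_add_I (m := r₂ * r₃ / r₁ * (R * P / (R - P)) ^ 2)
      (by positivity) ?_
    have hrp : D.dir r p * D.dir p r = D.dir r a * D.dir p a := by
      have hpow := I_pow_val_sub_mul 0 (D.rot r p - D.rot r a)
      rw [zero_sub, ZMod.val_zero, pow_zero] at hpow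
      rw [D.dir_eq_mul h.rp h.ar.symm, D.dir_eq_mul h.rp.symm h.ap.symm,
        ← neg_eq_of_add_eq_zero_right htri]
      linear_combination (D.dir r a * D.dir p a) * hpow
    have nR := coord_ne (D.pos_ne haf) hk hR
    have nP := coord_ne (D.pos_ne haf) hk hP
    have c₁ : D.pos r - D.pos a = R * (D.pos f - D.pos a) / (R - k) := by
      rw [eq_moebius (D.pos_ne haf) hk hR]; field_simp; ring
    have c₂ : D.pos p - D.pos a = P * (D.pos f - D.pos a) / (P - k) := by
      rw [eq_moebius (D.pos_ne haf) hk hP]; field_simp; ring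
    have c₃ : D.pos p - D.pos r =
        k * (D.pos f - D.pos a) * (R - P) / ((P - k) * (R - k)) := by
      rw [eq_moebius (D.pos_ne haf) hk hR, eq_moebius (D.pos_ne haf) hk hP]; field_simp; ring
    have hprod : Complex.I * D.dir a r ^ 2 * (r₁ * (D.pos p - D.pos r) ^ 2) =
        -(r₂ * r₃ * (D.pos r - D.pos a) ^ 2 * (D.pos p - D.pos a) ^ 2) := by
      rw [dap] at e₃
      linear_combination (Complex.I * D.dir a r ^ 2) * (e₁ - hrp) -
        (Complex.I * D.dir a r * D.dir p a) * e₂ + (r₂ * (D.pos r - D.pos a) ^ 2) * e₃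
    have nfa : D.pos f - D.pos a ≠ 0 := sub_ne_zero.2 (D.pos_ne haf.symm)
    have hr₁C : (r₁ : ℂ) ≠ 0 := by exact_mod_cast hr₁.ne'
    have hRPC : (R : ℂ) - P ≠ 0 := by exact_mod_cast hRP
    rw [c₁, c₂, c₃] at hprod
    have hkey : Complex.I * D.dir a r ^ 2 * (r₁ * (k * (R - P)) ^ 2) =
        -(r₂ * r₃ * (R * P) ^ 2 * (D.pos f - D.pos a) ^ 2) := by
      have nfac : ((D.pos f - D.pos a) / ((P - k) * (R - k))) ^ 2 ≠ 0 :=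
        pow_ne_zero 2 (div_ne_zero nfa (mul_ne_zero nP nR))
      apply mul_right_cancel₀ nfac
      refine Eq.trans ?_ (hprod.trans ?_) <;> field_simp
    push_cast
    rw [div_pow, div_eq_iff (pow_ne_zero 2 naf)]
    field_simp
    linear_combination (-Complex.I) * hkey + (D.dir a r ^ 2 * r₁ * (k * (R - P)) ^ 2) * hI
  have dir_of : ∀ {κ : ℂ} {τ : ℝ}, D.dir a r * κ = τ * (1 + Complex.I) * (D.pos a - D.pos f) →
      D.dir a p * κ = τ * (-1 + Complex.I) * (D.pos a - D.pos f) ∧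
      D.dir a q * κ = τ * (-1 - Complex.I) * (D.pos a - D.pos f) ∧
      D.dir a s * κ = τ * (1 - Complex.I) * (D.pos a - D.pos f) := by
    intro κ τ hκ
    refine ⟨?_, ?_, ?_⟩
    · rw [dap]; linear_combination Complex.I * hκ + τ * (D.pos a - D.pos f) * hI
    · rw [daq]; linear_combination -hκ
    · rw [das]; linear_combination -Complex.I * hκ - τ * (D.pos a - D.pos f) * hI
  rw [div_eq_iff naf] at ht
  rcases ht0.lt_or_gt with hneg | hpos
  · have ht' : D.dir a r * (-k) = ((-t : ℝ) : ℂ) * (1 + Complex.I) * (D.pos a - D.pos f) := by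
      push_cast; linear_combination -ht
    have htpos : 0 < -t := by linarith
    obtain ⟨h1, h2, h3⟩ := dir_of ht'
    have neg_coord : ∀ {x : V} {X : ℝ}, k * (D.pos x - D.pos a) = X * (D.pos x - D.pos f) →
        -k * (D.pos x - D.pos a) = ((-X : ℝ) : ℂ) * (D.pos x - D.pos f) := by
      intro x X hX
      push_cast; linear_combination -hX
    exact D.false_of_arcs haf (neg_ne_zero.2 hk) hpr hpq hrq hrs hqs h.fp.symm h.fr.symm h.fq.symm
      h.fs.symm ⟨h.ar, neg_coord hR, -t, htpos, ht'⟩ ⟨h.ap, neg_coord hP, -t, htpos, h1⟩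
      ⟨h.aq, neg_coord hQ, -t, htpos, h2⟩ ⟨h.as, neg_coord hS, -t, htpos, h3⟩ drf dpf dqf dsf
      (neg_ne_zero.2 hP0) (neg_ne_zero.2 hR0) (neg_ne_zero.2 hQ0) (neg_ne_zero.2 hS0)
  · obtain ⟨h1, h2, h3⟩ := dir_of ht
    exact D.false_of_arcs haf hk hpr hpq hrq hrs hqs h.fp.symm h.fr.symm h.fq.symm
      h.fs.symm ⟨h.ar, hR, t, hpos, ht⟩ ⟨h.ap, hP, t, hpos, h1⟩
      ⟨h.aq, hQ, t, hpos, h2⟩ ⟨h.as, hS, t, hpos, h3⟩ drf dpf dqf dsf hP0 hR0 hQ0 hS0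

end RightAngleDrawing

theorem ZMod.cyclic_order : ∀ P R Q S : ZMod 4, P ≠ R → P ≠ Q → P ≠ S → R ≠ Q → R ≠ S → Q ≠ S →
    R - P ≠ 2 →
    (P - R = 1 ∧ Q - R = 2 ∧ S - R = -1) ∨ (P - R = 1 ∧ S - R = 2 ∧ Q - R = -1) ∨
    (R - P = 1 ∧ Q - P = 2 ∧ S - P = -1) ∨ (R - P = 1 ∧ S - P = 2 ∧ Q - P = -1) := by decide

theorem RightAngleDrawing.false_of_pattern {V : Type*} {G : SimpleGraph V}
    {a f p r q s x₁ x₂ x₃ y₁ y₂ y₃ : V} (D : RightAngleDrawing G)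
    (h : DoubledPattern G a f p r q s x₁ x₂ x₃ y₁ y₂ y₃) : False := by
  have hnd := h.nodup
  simp only [List.nodup_cons, List.mem_cons, List.not_mem_nil, or_false, not_or] at hnd
  have rot_ne : ∀ {v w w' : V}, G.Adj v w → G.Adj v w' → w ≠ w' → D.rot v w ≠ D.rot v w' :=
    fun hw hw' hne he => hne (D.rot_inj hw hw' he)
  rcases ZMod.cyclic_order _ _ _ _ (rot_ne h.ap h.ar (by grind)) (rot_ne h.ap h.aq (by grind))
    (rot_ne h.ap h.as (by grind)) (rot_ne h.ar h.aq (by grind)) (rot_ne h.ar h.as (by grind))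
    (rot_ne h.aq h.as (by grind)) (D.rot_triangle h).1 with
    ⟨h1, h2, h3⟩ | ⟨h1, h2, h3⟩ | ⟨h1, h2, h3⟩ | ⟨h1, h2, h3⟩
  · exact D.false_of_ordered h h1 h2 h3
  · exact D.false_of_ordered h.flip_second h1 h2 h3
  · exact D.false_of_ordered h.flip_first h1 h2 h3
  · exact D.false_of_ordered h.flip_first.flip_second h1 h2 h3

theorem G18_doubledPattern : DoubledPattern G18 0 5 4 2 3 1 6 8 7 12 14 13 := by
  constructor <;> decide

theorem G18_not_hasPlanarLombardiDrawing : ¬ HasPlanarLombardiDrawing G18 := by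
  rintro ⟨D, hP, hL⟩
  obtain ⟨D'⟩ := D.exists_rightAngleDrawing G18_regular hP hL
  exact D'.false_of_pattern G18_doubledPattern

theorem theorem4 :
    (G18.IsRegularOfDegree 4 ∧ IsTwoConnected G18 ∧ IsPlanarGraph G18 ∧
      ¬ HasPlanarLombardiDrawing G18) ∧
    ¬ ∀ (V : Type) [Fintype V] (G : SimpleGraph V) [DecidableRel G.Adj],
      G.IsRegularOfDegree 4 → IsPlanarGraph G → HasPlanarLombardiDrawing G :=
  ⟨⟨G18_regular, G18_twoConnected, G18_isPlanarGraph, G18_not_hasPlanarLombardiDrawing⟩,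
    fun h => G18_not_hasPlanarLombardiDrawing (h (Fin 18) G18 G18_regular G18_isPlanarGraph)⟩
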